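/- Let $V$ be a finite-dimensional real vector space with a scalar product $\langle\cdot,\cdot\rangle$, and let $X=[a_1,\dots,a_m]$ be a finite list of nonzero vectors of $V$ that generates a pointed cone (a cone containing no line). **Notation.** For a list $b=[b_1,\dots,b_n]$ of nonzero vectors generating a pointed cone, the multivariate spline $T_b$ is the distribution $$\langle T_b\,|\,f\rangle=\int_0^\infty\!\!\cdots\int_0^\infty f\Big(\sum_{i=1}^n t_ib_i\Big)\,dt_1\cdots dt_n .$$ A subspace $\underline r$ of $V$ is *rational* if it is spanned by a sublist of $X$ (the subspace $0$ is spanned by the empty sublist); $S_X$ is the finite set of rational subspaces. For $\underline r\in S_X$ let $X\cap\underline r$ and $X\setminus\underline r$ be the sublists of the vectors of $X$ lying, respectively not lying, in $\underline r$. * A *tope* for $X\cap\underline r$ is a connected component of the complement in $\underline r$ of the union of the hyperplanes of $\underline r$ spanned by sublists of $X\cap\underline r$. * A vector $u\in\underline r^\perp$ is *regular* for $X\setminus\underline r$ if $\langle u,a\rangle\ne0$ for all $a\in X\setminus\underline r$; a *regular face* is a connected component of the set of regular vectors in $\underline r^\perp$. For a regular face $F$ let $A$ and $B$ be the sublists of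 $X\setminus\underline r$ of the vectors that are positive, respectively negative, on $F$, and put $T^{F}_{X\setminus\underline r}=(-1)^{|B|}\,T_{[A,-B]}$, a distribution on $V$. * A *cocircuit* of $X\cap\underline r$ is a minimal sublist $Y$ whose complement in $X\cap\underline r$ does not span $\underline r$; $D(X\cap\underline r)$ is the space of distributions $g$ on $\underline r$ with $\prod_{a\in Y}\partial_a\,g=0$ for every cocircuit $Y$. For a tope $\tau$ for $X\cap\underline r$, $(T_{X\cap\underline r})^{\tau}$ denotes the polynomial density on $\underline r$ that belongs to $D(X\cap\underline r)$ and coincides on $\tau$ with the spline $T_{X\cap\underline r}$, regarded as a distribution on $\underline r$. * Distributions on $\underline r$ are regarded as distributions on $V$ by restricting test functions to $\underline r$, and $*$ is convolution of distributions on $V$, $\langle T*S\,|\,f\rangle=\langle S_y\,|\,\langle T_x\,|\,f(x+y)\rangle\rangle$. For $\beta\in V$ let $p_{\underline r}\beta$ and $p_{\underline r^\perp}\beta$ be its orthogonal projections to $\underline r$ and $\underline r^\perp$. Say that $\beta$ is *generic with respect to* $\underline r$ if $p_{\underline r}\beta$ lies in a tope $\tau(p_{\underline r}\beta)$ for $X\cap\underline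 r$ and $p_{\underline r^\perp}\beta$ is regular for $X\setminus\underline r$; in that case let $F^\beta_{\underline r}$ be the regular face for $X\setminus\underline r$ containing $p_{\underline r^\perp}\beta$. **Theorem (Paradan).** Let $\beta\in V$ be generic with respect to all rational subspaces $\underline r\in S_X$. Then, for every $\underline r\in S_X$, the polynomial density $(T_{X\cap\underline r})^{\tau(p_{\underline r}\beta)}$ exists and is unique, the convolution below is well defined, and $$T_X=\sum_{\underline r\in S_X}T^{-F^\beta_{\underline r}}_{X\setminus\underline r}*\big(T_{X\cap\underline r}\big)^{\tau(p_{\underline r}\beta)} .$$ -/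

import Mathlib

open MeasureTheory TopologicalSpace
open scoped Distributions LineDeriv Topology Pointwise RealInnerProductSpace

namespace Spline

noncomputable section

/-- Test functions: compactly supported smooth real functions on `E`. -/
abbrev Test (E : Type*) [NormedAddCommGroup E] [NormedSpace ℝ E] : Type _ :=
  𝓓((⊤ : Opens E), ℝ)

/-- Distributions on `E`. -/
abbrev Distr (E : Type*) [NormedAddCommGroup E] [NormedSpace ℝ E] : Type _ :=
  𝓓'((⊤ : Opens E), ℝ)

/-! ### General operations on distributions -/

/-- The distribution `f ↦ ∫ f p dμ` (for `p` locally `μ`-integrable; it is `0` otherwise). -/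
def ofDensity {E : Type*} [NormedAddCommGroup E] [NormedSpace ℝ E] [MeasurableSpace E]
    [BorelSpace E] (μ : Measure E) (p : E → ℝ) : Distr E where
  toFun f := TestFunction.integralAgainstBilinCLM (ContinuousLinearMap.mul ℝ ℝ) μ p f
  map_add' f g := map_add _ f g
  map_smul' c f := map_smul _ c f
  cont := ContinuousLinearMap.continuous _

/-- The translated test function `x ↦ f (x + y)`. -/
def translate {E : Type*} [NormedAddCommGroup E] [NormedSpace ℝ E] (y : E) (f : Test E) :
    Test E where
  toFun x := f (x + y)
  contDiff' := f.contDiff.comp (contDiff_id.add contDiff_const)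
  hasCompactSupport' := f.hasCompactSupport.comp_homeomorph (Homeomorph.addRight y)
  tsupport_subset' := fun _ _ => trivial

/-- `R` is the convolution `T * S`: for every test function `f` one has
`⟨R | f⟩ = ⟨S_y | ⟨T_x | f (x + y)⟩⟩`, where the possibly not compactly supported function
`y ↦ ⟨T_x | f (x + y)⟩` may be replaced by a test function `φ` that agrees with it
in a neighbourhood of the support of `S`. -/
def IsConvolution {E : Type*} [NormedAddCommGroup E] [NormedSpace ℝ E] (T S R : Distr E) : Prop :=
  ∀ f : Test E, ∃ φ : Test E,
    (∀ᶠ y in 𝓝ˢ (Distribution.dsupport S), φ y = T (translate y f)) ∧ R f = S φ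

open Classical in
/-- The convolution `T * S` (and `0` if it is not defined). -/
def conv {E : Type*} [NormedAddCommGroup E] [NormedSpace ℝ E] (T S : Distr E) : Distr E :=
  if h : ∃ R, IsConvolution T S R then h.choose else 0

/-- Restriction of a test function on `V` to a subspace `r`. -/
def restrictTest {V : Type*} [NormedAddCommGroup V] [NormedSpace ℝ V] [FiniteDimensional ℝ V]
    (r : Submodule ℝ V) (f : Test V) : Test r where
  toFun x := f x
  contDiff' := f.contDiff.comp r.subtypeL.contDiff
  hasCompactSupport' :=
    f.hasCompactSupport.comp_isClosedEmbedding (r.closed_of_finiteDimensional.isClosedEmbedding_subtypeVal)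
  tsupport_subset' := fun _ _ => trivial

/-- Restriction of test functions to a subspace is continuous. -/
theorem continuous_comp_restrictTest {V : Type*} [NormedAddCommGroup V] [NormedSpace ℝ V]
    [FiniteDimensional ℝ V] (r : Submodule ℝ V) (S : Test r →L[ℝ] ℝ) (K : Compacts V)
    (hK : (K : Set V) ⊆ (⊤ : Opens V)) :
    Continuous ((fun f : Test V => S (restrictTest r f)) ∘ TestFunction.ofSupportedIn hK) := by
  let K' : Compacts r := ⟨Subtype.val ⁻¹' (K : Set V),
    r.closed_of_finiteDimensional.isClosedEmbedding_subtypeVal.isCompact_preimage K.isCompact⟩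
  let A : ContDiffMapSupportedIn V ℝ ⊤ K →ₗ[ℝ] ContDiffMapSupportedIn r ℝ ⊤ K' :=
    { toFun f := ⟨fun x => f x, f.contDiff.comp r.subtypeL.contDiff,
        fun x hx => f.zero_on_compl (x := (x : V)) hx⟩
      map_add' _ _ := rfl
      map_smul' _ _ := rfl }
  have hA : Continuous A := by
    refine WithSeminorms.continuous_of_isBounded (ContDiffMapSupportedIn.withSeminorms ℝ V ℝ ⊤ K)
      (ContDiffMapSupportedIn.withSeminorms ℝ r ℝ ⊤ K') _ (.of_real fun i => ?_)
    refine ⟨{i}, ‖r.subtypeL‖ ^ i, fun f => ?_⟩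
    refine (ContDiffMapSupportedIn.seminorm_top_le_iff ℝ
      (mul_nonneg (by positivity) (apply_nonneg _ _)) i (A f)).2 fun x _ => ?_
    have h := r.subtypeL.iteratedFDeriv_comp_right (f := (f : V → ℝ)) f.contDiff x
      (i := i) (by exact_mod_cast le_top)
    change ‖iteratedFDeriv ℝ i ((f : V → ℝ) ∘ r.subtypeL) x‖ ≤ _
    rw [h]
    refine (ContinuousMultilinearMap.norm_compContinuousLinearMap_le _ _).trans ?_
    rw [Finset.prod_const, Finset.card_univ, Fintype.card_fin, Finset.sup_singleton, mul_comm]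
    gcongr
    exact ContDiffMapSupportedIn.norm_iteratedFDeriv_apply_le_seminorm_top ℝ
  have hS := S.continuous.comp
    ((TestFunction.continuous_ofSupportedIn (F := ℝ) (n := ⊤) (K := K')
      (Ω := (⊤ : Opens r)) (fun _ _ => trivial)).comp hA)
  exact hS

/-- The distribution on `V`, supported on the subspace `r`, that corresponds to a distribution
on `r`: it is evaluated by restricting test functions to `r`. -/
def extend {V : Type*} [NormedAddCommGroup V] [NormedSpace ℝ V] [FiniteDimensional ℝ V]
    (r : Submodule ℝ V) (S : Distr r) : Distr V where
  toFun f := S (restrictTest r f)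
  map_add' f g := map_add S (restrictTest r f) (restrictTest r g)
  map_smul' c f := map_smul S c (restrictTest r f)
  cont := (TestFunction.mkCLM ℝ (fun f : Test V => S (restrictTest r f))
    (fun f g => map_add S (restrictTest r f) (restrictTest r g))
    (fun c f => map_smul S c (restrictTest r f))
    (fun K hK => continuous_comp_restrictTest r S K hK)).continuous

/-- The iterated directional derivative `∏_{i ∈ Y} ∂_{a i}` (the factors commute). -/
def derivAlong {E ι : Type*} [NormedAddCommGroup E] [NormedSpace ℝ E] (a : ι → E)
    (Y : Finset ι) (T : Distr E) : Distr E :=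
  Y.toList.foldr (fun i S => ∂_{a i} S) T

/-! ### Rational subspaces, topes, cocircuits

A finite list of vectors of `E` is a family `a : ι → E` indexed by a finite type. -/

open Classical in
/-- The set `S_X` of rational subspaces: the spans of the sublists of `a`. -/
def rationalSubspaces {E ι : Type*} [AddCommGroup E] [Module ℝ E] [Fintype ι] (a : ι → E) :
    Finset (Submodule ℝ E) :=
  Finset.univ.image fun s : Finset ι => Submodule.span ℝ (a '' s)

/-- The sublist `X ∩ r` of the vectors lying in `r`, as a list of vectors of `r`. -/
def inter {E ι : Type*} [AddCommGroup E] [Module ℝ E] (a : ι → E) (r : Submodule ℝ E) :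
    {i // a i ∈ r} → r :=
  fun i => ⟨a i, i.2⟩

/-- The complement of the union of the hyperplanes generated by sublists of `a`. -/
def topeComplement {E ι : Type*} [AddCommGroup E] [Module ℝ E] [Fintype ι] (a : ι → E) : Set E :=
  {x | ∀ H ∈ rationalSubspaces a, IsCoatom H → x ∉ H}

/-- The tope of `a` containing `x`: the connected component of `x` in the complement of the
hyperplanes generated by sublists of `a`. -/
def tope {E ι : Type*} [NormedAddCommGroup E] [NormedSpace ℝ E] [Fintype ι] (a : ι → E) (x : E) :
    Set E :=
  connectedComponentIn (topeComplement a) x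

/-- A cocircuit: a sublist whose complement does not span, minimal with this property. -/
def IsCocircuit {E ι : Type*} [AddCommGroup E] [Module ℝ E] (a : ι → E) (Y : Finset ι) : Prop :=
  Minimal (fun Y : Finset ι => Submodule.span ℝ (a '' {i | i ∉ Y}) ≠ ⊤) Y

/-- The space `D(X)`: the distributions killed by `∂_Y` for all cocircuits `Y`. -/
def dahmenMicchelli {E ι : Type*} [NormedAddCommGroup E] [NormedSpace ℝ E] (a : ι → E) :
    Set (Distr E) :=
  {T | ∀ Y : Finset ι, IsCocircuit a Y → derivAlong a Y T = 0}

/-- Polynomial densities `P(x) dx`, where a polynomial function is an element of the algebra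
generated by the linear forms. -/
def IsPolynomialDensity {E : Type*} [NormedAddCommGroup E] [InnerProductSpace ℝ E]
    [FiniteDimensional ℝ E] [MeasurableSpace E] [BorelSpace E] (Q : Distr E) : Prop :=
  ∃ p ∈ Algebra.adjoin ℝ (Set.range fun (l : E →ₗ[ℝ] ℝ) => (l : E → ℝ)),
    Q = ofDensity volume p

/-- `Q` is a polynomial density in `D(X)` that coincides with `T` on `τ`. -/
def IsPolynomialPart {E ι : Type*} [NormedAddCommGroup E] [InnerProductSpace ℝ E]
    [FiniteDimensional ℝ E] [MeasurableSpace E] [BorelSpace E] (a : ι → E) (T : Distr E)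
    (τ : Set E) (Q : Distr E) : Prop :=
  IsPolynomialDensity Q ∧ Q ∈ dahmenMicchelli a ∧ ∀ f : Test E, tsupport f ⊆ τ → T f = Q f

open Classical in
/-- `T^τ`: the polynomial density in `D(X)` that coincides with `T` on `τ`
(and `0` if there is none). -/
def polynomialPart {E ι : Type*} [NormedAddCommGroup E] [InnerProductSpace ℝ E]
    [FiniteDimensional ℝ E] [MeasurableSpace E] [BorelSpace E] (a : ι → E) (T : Distr E)
    (τ : Set E) : Distr E :=
  if h : ∃ Q, IsPolynomialPart a T τ Q then h.choose else 0

/-! ### Multivariate splines -/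

/-- The image of Lebesgue measure on the orthant `{t | ∀ i, 0 ≤ t i}` under `t ↦ ∑ i, t i • b i`. -/
def splineMeasure {E ι : Type*} [NormedAddCommGroup E] [NormedSpace ℝ E] [MeasurableSpace E]
    [Fintype ι] (b : ι → E) : Measure E :=
  Measure.map (fun t : ι → ℝ => ∑ i, t i • b i) (volume.restrict {t | ∀ i, 0 ≤ t i})

/-- The multivariate spline `T_b`, for a list `b` of nonzero vectors that generates a pointed cone;
see `spline_apply`. -/
def spline {E ι : Type*} [NormedAddCommGroup E] [NormedSpace ℝ E] [MeasurableSpace E]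
    [BorelSpace E] [Fintype ι] (b : ι → E) : Distr E :=
  ofDensity (splineMeasure b) fun _ => 1

/-- `b` generates a pointed cone, that is, a cone that contains no line. -/
def GeneratesPointedCone {E ι : Type*} [AddCommGroup E] [Module ℝ E] (b : ι → E) : Prop :=
  ((PointedCone.hull ℝ (Set.range b) : PointedCone ℝ E) : ConvexCone ℝ E).Salient

/-- The defining formula `⟨T_b | f⟩ = ∫_{t ≥ 0} f (∑ i, t i • b i) dt` of the multivariate spline. -/
theorem spline_apply {E ι : Type*} [NormedAddCommGroup E] [NormedSpace ℝ E] [MeasurableSpace E]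
    [BorelSpace E] [Fintype ι] (b : ι → E) (hb : ∀ i, b i ≠ 0) (hp : GeneratesPointedCone b)
    (f : Test E) :
    spline b f = ∫ t in {t : ι → ℝ | ∀ i, 0 ≤ t i}, f (∑ i, t i • b i) := by
  classical
  have hmem : ∀ (s : Finset ι) (t : ι → ℝ), (∀ i, 0 ≤ t i) →
      ∑ i ∈ s, t i • b i ∈ PointedCone.hull ℝ (Set.range b) := fun s t ht =>
    sum_mem fun i _ => Submodule.smul_mem _ (⟨t i, ht i⟩ : NNReal)
      (Submodule.subset_span (Set.mem_range_self i))
  have hcont : Continuous fun t : ι → ℝ => ∑ i, t i • b i := by fun_prop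
  obtain ⟨c, hc, hct⟩ : ∃ c : ℝ, 0 < c ∧ ∀ t : ι → ℝ, (∀ i, 0 ≤ t i) →
      c * ∑ i, t i ≤ ‖∑ i, t i • b i‖ := by
    rcases isEmpty_or_nonempty ι with he | ⟨⟨i0⟩⟩
    · exact ⟨1, one_pos, by simp⟩
    obtain ⟨t0, ht0, hmin⟩ := (isCompact_stdSimplex ℝ ι).exists_isMinOn
      ⟨_, single_mem_stdSimplex ℝ i0⟩ hcont.norm.continuousOn
    refine ⟨‖∑ i, t0 i • b i‖, norm_pos_iff.2 fun h0 => ?_, fun t ht => ?_⟩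
    · obtain ⟨j, hj⟩ : ∃ j, t0 j ≠ 0 := by
        by_contra! h
        have := ht0.2
        simp [h] at this
      have hsum := Finset.add_sum_erase Finset.univ (fun i => t0 i • b i) (Finset.mem_univ j)
      rw [h0] at hsum
      refine hp (t0 j • b j) ?_ (smul_ne_zero hj (hb j)) ?_
      · simpa using hmem {j} t0 ht0.1
      · rw [neg_eq_of_add_eq_zero_right hsum]
        exact hmem _ t0 ht0.1
    · rcases (Finset.sum_nonneg fun i (_ : i ∈ Finset.univ) => ht i).eq_or_lt with h | h
      · rw [← h, mul_zero]
        exact norm_nonneg _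
      · have hs : (fun i => (∑ j, t j)⁻¹ * t i) ∈ stdSimplex ℝ ι :=
          ⟨fun i => mul_nonneg (inv_nonneg.2 h.le) (ht i), by
            rw [← Finset.mul_sum, inv_mul_cancel₀ h.ne']⟩
        have h2 : ‖∑ i, t0 i • b i‖ ≤ ‖∑ i, ((∑ j, t j)⁻¹ * t i) • b i‖ := hmin hs
        simp only [mul_smul, ← Finset.smul_sum, norm_smul, norm_inv,
          Real.norm_of_nonneg h.le] at h2
        rwa [le_inv_mul_iff₀ h, mul_comm] at h2
  have hfin : IsLocallyFiniteMeasure (splineMeasure b) := by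
    refine ⟨fun x => ⟨Metric.ball x 1, Metric.ball_mem_nhds x one_pos, ?_⟩⟩
    rw [splineMeasure, Measure.map_apply hcont.measurable measurableSet_ball,
      Measure.restrict_apply (hcont.measurable measurableSet_ball)]
    refine (measure_mono ?_).trans_lt
      (measure_closedBall_lt_top (x := (0 : ι → ℝ)) (r := c⁻¹ * (‖x‖ + 1)))
    rintro t ⟨ht1, ht2⟩
    rw [mem_closedBall_zero_iff, pi_norm_le_iff_of_nonneg (by positivity)]
    intro i
    rw [Real.norm_of_nonneg (ht2 i), le_inv_mul_iff₀ hc]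
    have h1 : t i ≤ ∑ j, t j := Finset.single_le_sum (fun j _ => ht2 j) (Finset.mem_univ i)
    have h3 : ‖∑ i, t i • b i - x‖ < 1 := by simpa [dist_eq_norm] using ht1
    have h4 := norm_sub_norm_le (∑ i, t i • b i) x
    nlinarith [hct t ht2]
  have hloc : LocallyIntegrableOn (fun _ : E => (1 : ℝ)) ((⊤ : Opens E) : Set E)
      (splineMeasure b) := (locallyIntegrable_const (1 : ℝ)).locallyIntegrableOn _
  change TestFunction.integralAgainstBilinCLM (ContinuousLinearMap.mul ℝ ℝ) (splineMeasure b)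
    (fun _ => 1) f = _
  rw [TestFunction.integralAgainstBilinCLM_eq_integral hloc]
  simp only [ContinuousLinearMap.mul_apply', mul_one]
  exact integral_map hcont.measurable.aemeasurable f.aestronglyMeasurable

/-! ### Regular faces and genericity -/

/-- The regular vectors for `X ∖ r`: the vectors of `rᗮ` orthogonal to no element of `X ∖ r`. -/
def regularVectors {V ι : Type*} [NormedAddCommGroup V] [InnerProductSpace ℝ V] (a : ι → V)
    (r : Submodule ℝ V) : Set V :=
  {u | u ∈ rᗮ ∧ ∀ i, a i ∉ r → ⟪u, a i⟫ ≠ 0}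

/-- The regular face for `X ∖ r` containing the regular vector `u`, that is, the open face of the
hyperplane arrangement defined by `X ∖ r` in `rᗮ`. -/
def regularFace {V ι : Type*} [NormedAddCommGroup V] [InnerProductSpace ℝ V] (a : ι → V)
    (r : Submodule ℝ V) (u : V) : Set V :=
  connectedComponentIn (regularVectors a r) u

open Classical in
/-- The list `[A, -B]`, where `B` consists of the vectors of `X ∖ r` that are negative on the face
`F`, and `A` of the others (which are positive on `F` if `F` is a regular face). -/
def signed {V ι : Type*} [NormedAddCommGroup V] [InnerProductSpace ℝ V] (a : ι → V)
    (r : Submodule ℝ V) (F : Set V) : {i // a i ∉ r} → V :=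
  fun i => if ∀ u ∈ F, ⟪u, a i⟫ < 0 then -a i else a i

open Classical in
/-- The number `|B|` of vectors of `X ∖ r` that are negative on the face `F`. -/
def numNeg {V ι : Type*} [NormedAddCommGroup V] [InnerProductSpace ℝ V] [Fintype ι] (a : ι → V)
    (r : Submodule ℝ V) (F : Set V) : ℕ :=
  (Finset.univ.filter fun i => a i ∉ r ∧ ∀ u ∈ F, ⟪u, a i⟫ < 0).card

open Classical in
/-- The distribution `T_{X ∖ r}^F = (-1)^|B| T_{[A, -B]}`. -/
def faceSpline {V ι : Type*} [NormedAddCommGroup V] [InnerProductSpace ℝ V] [MeasurableSpace V]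
    [BorelSpace V] [Fintype ι] (a : ι → V) (r : Submodule ℝ V) (F : Set V) : Distr V :=
  ((-1 : ℝ) ^ numNeg a r F) • spline (signed a r F)

open Classical in
/-- `β` is generic with respect to `r`: its projection to `r` lies in a tope of `X ∩ r`, and its
projection to `rᗮ` is regular for `X ∖ r`. -/
def IsGeneric {V ι : Type*} [NormedAddCommGroup V] [InnerProductSpace ℝ V]
    [FiniteDimensional ℝ V] [Fintype ι] (a : ι → V) (r : Submodule ℝ V) (β : V) : Prop :=
  r.orthogonalProjectionOnto β ∈ topeComplement (inter a r) ∧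
    rᗮ.starProjection β ∈ regularVectors a r

open Classical in
/-- The regular face `F_r^β` for `X ∖ r` that contains the projection of `β` to `rᗮ`. -/
def betaFace {V ι : Type*} [NormedAddCommGroup V] [InnerProductSpace ℝ V]
    [FiniteDimensional ℝ V] (a : ι → V) (r : Submodule ℝ V) (β : V) : Set V :=
  regularFace a r (rᗮ.starProjection β)

open Classical in
/-- The tope `τ(p_r β)` for `X ∩ r` that contains the projection of `β` to `r`. -/
def betaTope {V ι : Type*} [NormedAddCommGroup V] [InnerProductSpace ℝ V]
    [FiniteDimensional ℝ V] [Fintype ι] (a : ι → V) (r : Submodule ℝ V) (β : V) : Set r :=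
  tope (inter a r) (r.orthogonalProjectionOnto β)

open Classical in
/-- The multivariate spline `T_{X ∩ r}`, as a distribution on `r`. -/
def interSpline {V ι : Type*} [NormedAddCommGroup V] [InnerProductSpace ℝ V]
    [MeasurableSpace V] [BorelSpace V] [Fintype ι] (a : ι → V) (r : Submodule ℝ V) : Distr r :=
  spline (inter a r)

end

end Spline

namespace Spline

open Set Filter
open scoped ContDiff

noncomputable section

/-! The decomposition is proved for every sublist `s` of X at once, keeping the topes and regular
faces of the full list X (`integral_coneMeasure_eq_sum_termValue`), by strong induction on `s`. Let
W be the span of `s`. For `a j` in `s`, the derivative ∂_{a j} turns T_s into the spline of `s`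
without `a j`, and it turns each summand for `s` into the corresponding summand for the shorter list
(`GoodSubspace.termValue_dirDeriv`): it acts on the polynomial factor if `a j ∈ r` and on the cone
factor otherwise. By induction the difference of the two sides is killed by all these derivatives,
hence is invariant under translations by W. By `eq_zero_of_invariant` it then suffices that the
difference vanishes on test functions whose support meets W only near one point of W.

That point is the projection p_W β. If r is not contained in W, the vectors of `s` in r do not span
r, so the polynomial factor is 0. If r is a proper subspace of W, the summand lives on the
half-space ⟨p_{r⊥} β, x⟩ ≤ 0, whereas p_W β lies strictly on the other side
(`inner_starProjection_pos`). The summand r = W is the polynomial that agrees with T_s on the tope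
of p_W β. So both sides agree there.

Splines are polynomial on topes by homogeneity: Euler's identity and the derivative rule give (|s| −
dim) T_s = ∑ x_i T_{s∖i}, summed over a basis contained in `s` (`integral_coneMeasure_recursion`),
which allows an induction starting from simplicial cones and non-spanning lists
(`AvoidsHyperplanes.exists_isPoly`). Differentiating along a cocircuit leaves a non-spanning list,
whose local polynomial is 0; this is membership in D(X).

The convolutions exist because the flipped vectors lie strictly on one side of a hyperplane
containing r, so that the correlation of a test function with the cone measure vanishes far out near
r (`exists_shiftInt_eq_zero`). -/

/-- Smooth functions with compact support. -/
structure IsTest {E : Type*} [NormedAddCommGroup E] [NormedSpace ℝ E] (f : E → ℝ) : Prop where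
  contDiff : ContDiff ℝ ∞ f
  hasCompactSupport : HasCompactSupport f

/-! ### Operations on test functions -/

section IsTest

variable {E : Type*} [NormedAddCommGroup E] [NormedSpace ℝ E] {f g : E → ℝ}

theorem IsTest.continuous (hf : IsTest f) : Continuous f := hf.contDiff.continuous

theorem IsTest.differentiable (hf : IsTest f) : Differentiable ℝ f :=
  hf.contDiff.differentiable (by simp)

theorem IsTest.of_test (f : Test E) : IsTest (f : E → ℝ) := ⟨f.contDiff, f.hasCompactSupport⟩

/-- A smooth compactly supported function as a bundled test function. -/
def IsTest.toTest (hf : IsTest f) : Test E where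
  toFun := f
  contDiff' := hf.contDiff
  hasCompactSupport' := hf.hasCompactSupport
  tsupport_subset' := fun _ _ => trivial

@[simp]
theorem IsTest.toTest_apply (hf : IsTest f) (x : E) : hf.toTest x = f x := rfl

/-- The derivative of `f` in the direction `v`. -/
def dirDeriv (v : E) (f : E → ℝ) : E → ℝ := fun x => fderiv ℝ f x v

theorem contDiff_dirDeriv (hf : ContDiff ℝ ∞ f) (v : E) : ContDiff ℝ ∞ (dirDeriv v f) :=
  (hf.fderiv_right (m := ∞) (by simp)).clm_apply contDiff_const

theorem IsTest.dirDeriv (hf : IsTest f) (v : E) : IsTest (dirDeriv v f) :=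
  ⟨contDiff_dirDeriv hf.contDiff v, hf.hasCompactSupport.fderiv_apply (𝕜 := ℝ) v⟩

theorem tsupport_dirDeriv_subset (v : E) (f : E → ℝ) : tsupport (dirDeriv v f) ⊆ tsupport f :=
  tsupport_fderiv_apply_subset ℝ v

theorem IsTest.zero : IsTest (fun _ : E => (0 : ℝ)) :=
  ⟨contDiff_const, HasCompactSupport.zero⟩

theorem IsTest.add (hf : IsTest f) (hg : IsTest g) : IsTest (fun x => f x + g x) :=
  ⟨hf.contDiff.add hg.contDiff, hf.hasCompactSupport.add hg.hasCompactSupport⟩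

theorem IsTest.mul_left {p : E → ℝ} (hp : ContDiff ℝ ∞ p) (hf : IsTest f) :
    IsTest (fun x => p x * f x) :=
  ⟨hp.mul hf.contDiff, hf.hasCompactSupport.mul_left⟩

theorem IsTest.translate (hf : IsTest f) (y : E) : IsTest (fun x => f (x + y)) :=
  ⟨hf.contDiff.comp (contDiff_id.add contDiff_const),
    hf.hasCompactSupport.comp_homeomorph (Homeomorph.addRight y)⟩

theorem IsTest.sum {κ : Type*} (s : Finset κ) {F : κ → E → ℝ} (hF : ∀ k ∈ s, IsTest (F k)) :
    IsTest (fun x => ∑ k ∈ s, F k x) := by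
  classical
  induction s using Finset.induction_on with
  | empty => simpa using IsTest.zero
  | insert k s hk ih =>
    simp only [Finset.sum_insert hk]
    exact (hF k (by simp)).add (ih fun i hi => hF i (by simp [hi]))

theorem IsTest.exists_bound (hf : IsTest f) : ∃ C, 0 ≤ C ∧ ∀ x, |f x| ≤ C := by
  obtain ⟨C, hC⟩ := hf.hasCompactSupport.exists_bound_of_continuous hf.continuous
  exact ⟨C, (abs_nonneg _).trans (hC 0), hC⟩

theorem IsTest.exists_radius (hf : IsTest f) : ∃ M, 0 ≤ M ∧ ∀ x, M < ‖x‖ → f x = 0 := by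
  obtain ⟨M, hM⟩ := hf.hasCompactSupport.isCompact.isBounded.exists_norm_le
  refine ⟨|M|, abs_nonneg _, fun x hx => ?_⟩
  by_contra h
  exact absurd ((hM x (subset_tsupport _ h)).trans (le_abs_self M)) (not_le.2 hx)

theorem IsTest.restrict {V : Type*} [NormedAddCommGroup V] [NormedSpace ℝ V]
    [FiniteDimensional ℝ V] {f : V → ℝ} (hf : IsTest f) (r : Submodule ℝ V) :
    IsTest (fun x : r => f x) :=
  ⟨hf.contDiff.comp r.subtypeL.contDiff, hf.hasCompactSupport.comp_isClosedEmbedding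
    r.closed_of_finiteDimensional.isClosedEmbedding_subtypeVal⟩

theorem IsTest.integrable [MeasurableSpace E] [BorelSpace E] (hf : IsTest f) (μ : Measure E)
    [IsLocallyFiniteMeasure μ] : Integrable f μ :=
  hf.continuous.integrable_of_hasCompactSupport hf.hasCompactSupport

end IsTest

/-! ### The measure of a cone -/

open Classical in
/-- Lebesgue measure on the half-line if `P` holds, and the Dirac measure at `0` otherwise. -/
def rayOrDirac (P : Prop) : Measure ℝ := if P then volume.restrict (Ici 0) else Measure.dirac 0

instance (P : Prop) : SigmaFinite (rayOrDirac P) := by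
  unfold rayOrDirac; split_ifs <;> infer_instance

instance (P : Prop) : IsLocallyFiniteMeasure (rayOrDirac P) := by
  unfold rayOrDirac; split_ifs <;> infer_instance

theorem rayOrDirac_true {P : Prop} (h : P) : rayOrDirac P = volume.restrict (Ici 0) := if_pos h

theorem rayOrDirac_false {P : Prop} (h : ¬P) : rayOrDirac P = Measure.dirac 0 := if_neg h

section Cone

variable {V ι : Type*} [NormedAddCommGroup V] [NormedSpace ℝ V] [Fintype ι]

/-- Lebesgue measure on the coordinate orthant spanned by the coordinates in `s`. -/
def orthantMeasure (s : Finset ι) : Measure (ι → ℝ) := Measure.pi fun i => rayOrDirac (i ∈ s)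

instance (s : Finset ι) : SigmaFinite (orthantMeasure s) := by
  unfold orthantMeasure; infer_instance

instance (s : Finset ι) : IsLocallyFiniteMeasure (orthantMeasure s) := by
  unfold orthantMeasure; infer_instance

theorem ae_orthantMeasure (s : Finset ι) :
    ∀ᵐ t ∂orthantMeasure s, (∀ i, 0 ≤ t i) ∧ ∀ i, i ∉ s → t i = 0 := by
  have h (i : ι) : ∀ᵐ x ∂rayOrDirac (i ∈ s), 0 ≤ x ∧ (i ∉ s → x = 0) := by
    by_cases hi : i ∈ s
    · rw [rayOrDirac_true hi]
      filter_upwards [ae_restrict_mem measurableSet_Ici] with x hx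
      exact ⟨hx, fun h => absurd hi h⟩
    · rw [rayOrDirac_false hi, ae_dirac_iff (by measurability)]
      simp
  have h2 (i : ι) : ∀ᵐ t ∂orthantMeasure s, 0 ≤ t i ∧ (i ∉ s → t i = 0) :=
    Measure.tendsto_eval_ae_ae (μ := fun i => rayOrDirac (i ∈ s)) (i := i) |>.eventually (h i)
  filter_upwards [ae_all_iff.2 h2] with t ht
  exact ⟨fun i => (ht i).1, fun i => (ht i).2⟩

/-- `Φ_b(t) = ∑ i, t i • b i`. -/
def comb (b : ι → V) (t : ι → ℝ) : V := ∑ i, t i • b i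

theorem continuous_comb (b : ι → V) : Continuous (comb b) := by
  unfold comb; fun_prop

/-- The combinations of the vectors `b i`, `i ∈ s`, with nonnegative coefficients, are bounded below
by the sum of the coefficients, up to a positive constant. -/
def Coercive (b : ι → V) (s : Finset ι) : Prop :=
  ∃ c : ℝ, 0 < c ∧ ∀ t : ι → ℝ, (∀ i, 0 ≤ t i) → (∀ i, i ∉ s → t i = 0) →
    c * ∑ i, t i ≤ ‖comb b t‖

theorem Coercive.mono {b : ι → V} {s s' : Finset ι} (h : Coercive b s) (hs : s' ⊆ s) :
    Coercive b s' := by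
  obtain ⟨c, hc, H⟩ := h
  exact ⟨c, hc, fun t ht ht' => H t ht fun i hi => ht' i fun h => hi (hs h)⟩

theorem comb_single [DecidableEq ι] (b : ι → V) (j : ι) (x : ℝ) :
    comb b (Pi.single j x) = x • b j := by
  unfold comb
  rw [Finset.sum_eq_single j] <;> simp +contextual

theorem comb_update [DecidableEq ι] (b : ι → V) (t : ι → ℝ) (j : ι) (hj : t j = 0) (x : ℝ) :
    comb b (Function.update t j x) = comb b t + x • b j := by
  have : Function.update t j x = t + Pi.single j x := by
    ext i
    by_cases h : i = j
    · subst h; simp [hj]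
    · simp [h]
  rw [this, ← comb_single b j x]
  simp [comb, add_smul, Finset.sum_add_distrib]

theorem Coercive.ne_zero {b : ι → V} {s : Finset ι} (h : Coercive b s) {j : ι} (hj : j ∈ s) :
    b j ≠ 0 := by
  classical
  obtain ⟨c, hc, H⟩ := h
  intro h0
  have := H (Pi.single j 1) (fun i => by by_cases h : i = j <;> simp [h])
    (fun i hi => by
      have : i ≠ j := fun h => hi (h ▸ hj)
      simp [this])
  rw [comb_single, h0] at this
  simp at this
  linarith

/-- The constant is the least of the finitely many values `⟪u, b i⟫`, or 1 for the empty sublist. -/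
theorem coercive_of_inner {V : Type*} [NormedAddCommGroup V] [InnerProductSpace ℝ V]
    {b : ι → V} {s : Finset ι} {u : V} (h : ∀ i ∈ s, 0 < ⟪u, b i⟫) :
    ∃ c : ℝ, 0 < c ∧ ∀ t : ι → ℝ, (∀ i, 0 ≤ t i) → (∀ i, i ∉ s → t i = 0) →
      c * ∑ i, t i ≤ ⟪u, comb b t⟫ := by
  classical
  obtain ⟨c, hc, hcs⟩ : ∃ c : ℝ, 0 < c ∧ ∀ i ∈ s, c ≤ ⟪u, b i⟫ := by
    rcases s.eq_empty_or_nonempty with rfl | hs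
    · exact ⟨1, one_pos, by simp⟩
    · obtain ⟨j, hj, hmin⟩ := s.exists_min_image (fun i => ⟪u, b i⟫) hs
      exact ⟨_, h j hj, hmin⟩
  refine ⟨c, hc, fun t ht ht' => ?_⟩
  unfold comb
  rw [inner_sum, Finset.mul_sum]
  refine Finset.sum_le_sum fun i _ => ?_
  rw [real_inner_smul_right, mul_comm]
  by_cases hi : i ∈ s
  · exact mul_le_mul_of_nonneg_left (hcs i hi) (ht i)
  · simp [ht' i hi]

theorem Coercive.of_inner {V : Type*} [NormedAddCommGroup V] [InnerProductSpace ℝ V]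
    {b : ι → V} {s : Finset ι} {u : V} (h : ∀ i ∈ s, 0 < ⟪u, b i⟫) : Coercive b s := by
  obtain ⟨c, hc, H⟩ := coercive_of_inner h
  -- Cauchy–Schwarz; the summand 1 avoids dividing by zero, since `u = 0` is possible when `s` is
  -- empty.
  refine ⟨c / (‖u‖ + 1), by positivity, fun t ht ht' => ?_⟩
  rw [div_mul_eq_mul_div, div_le_iff₀ (by positivity)]
  have := (H t ht ht').trans (real_inner_le_norm _ _)
  nlinarith [norm_nonneg (comb b t)]

variable [MeasurableSpace V] [BorelSpace V]

/-- The image of Lebesgue measure on the orthant of `s` under `t ↦ ∑ i, t i • b i`. -/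
def coneMeasure (b : ι → V) (s : Finset ι) : Measure V := (orthantMeasure s).map (comb b)

/-- Coercivity confines the part of the orthant that is mapped into a unit ball to a bounded set of
parameters. -/
theorem Coercive.isLocallyFiniteMeasure {b : ι → V} {s : Finset ι} (h : Coercive b s) :
    IsLocallyFiniteMeasure (coneMeasure b s) := by
  obtain ⟨c, hc, hct⟩ := h
  refine ⟨fun x => ⟨Metric.ball x 1, Metric.ball_mem_nhds x one_pos, ?_⟩⟩
  rw [coneMeasure, Measure.map_apply (continuous_comb b).measurable measurableSet_ball]
  refine lt_of_le_of_lt (measure_mono_ae ?_)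
    (measure_closedBall_lt_top (x := (0 : ι → ℝ)) (r := c⁻¹ * (‖x‖ + 1)))
  filter_upwards [ae_orthantMeasure s] with t ht ht1
  change t ∈ Metric.closedBall 0 _
  rw [mem_closedBall_zero_iff, pi_norm_le_iff_of_nonneg (by positivity)]
  intro i
  rw [Real.norm_of_nonneg (ht.1 i), le_inv_mul_iff₀ hc]
  have h1 : t i ≤ ∑ j, t j := Finset.single_le_sum (fun j _ => ht.1 j) (Finset.mem_univ i)
  have h3 : ‖comb b t - x‖ < 1 := by
    have : comb b t ∈ Metric.ball x 1 := ht1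
    simpa [dist_eq_norm] using this
  have h4 := norm_sub_norm_le (comb b t) x
  nlinarith [hct t ht.1 ht.2]

theorem integral_coneMeasure (b : ι → V) (s : Finset ι) {f : V → ℝ} (hf : Continuous f) :
    ∫ x, f x ∂coneMeasure b s = ∫ t, f (comb b t) ∂orthantMeasure s :=
  integral_map (continuous_comb b).measurable.aemeasurable
    (hf.measurable.aestronglyMeasurable)

theorem Coercive.integrable_comp {b : ι → V} {s : Finset ι} (h : Coercive b s) {f : V → ℝ}
    (hf : Continuous f) (hc : HasCompactSupport f) :
    Integrable (fun t => f (comb b t)) (orthantMeasure s) := by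
  have := h.isLocallyFiniteMeasure
  exact (integrable_map_measure hf.measurable.aestronglyMeasurable
    (continuous_comb b).measurable.aemeasurable).1
    (hf.integrable_of_hasCompactSupport (μ := coneMeasure b s) hc)

/-- Integrals that vanish because the integrand vanishes on the cone. -/
theorem integral_coneMeasure_eq_zero (b : ι → V) (s : Finset ι) {f : V → ℝ} (hf : Continuous f)
    (h : ∀ t : ι → ℝ, (∀ i, 0 ≤ t i) → (∀ i, i ∉ s → t i = 0) → f (comb b t) = 0) :
    ∫ x, f x ∂coneMeasure b s = 0 := by
  rw [integral_coneMeasure b s hf]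
  refine integral_eq_zero_of_ae ?_
  filter_upwards [ae_orthantMeasure s] with t ht
  exact h t ht.1 ht.2

omit [MeasurableSpace V] [BorelSpace V] in
theorem comb_mem_span (b : ι → V) (s : Finset ι) {t : ι → ℝ} (ht : ∀ i, i ∉ s → t i = 0) :
    comb b t ∈ Submodule.span ℝ (b '' (s : Set ι)) := by
  refine Submodule.sum_mem _ fun i _ => ?_
  by_cases hi : i ∈ s
  · exact Submodule.smul_mem _ _ (Submodule.subset_span ⟨i, hi, rfl⟩)
  · simp [ht i hi]

theorem coneMeasure_empty (b : ι → V) : coneMeasure b ∅ = Measure.dirac 0 := by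
  have : orthantMeasure (∅ : Finset ι) = Measure.dirac 0 := by
    refine Measure.pi_eq fun s hs => ?_
    rw [Measure.dirac_apply' _ (MeasurableSet.univ_pi hs)]
    simp only [rayOrDirac_false (Finset.notMem_empty _), Measure.dirac_apply' _ (hs _)]
    classical
    simp [Set.indicator_apply, Finset.prod_ite_zero]
  rw [coneMeasure, this, Measure.map_dirac' (continuous_comb b).measurable]
  simp [comb]

/-! ### Fubini in one coordinate -/

/-- For `j ∉ s` the `j`-th factor of the orthant measure is a Dirac mass, of total mass 1, so
overwriting this coordinate by a half-line variable yields the orthant of `insert j s`. -/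
theorem measurePreserving_update [DecidableEq ι] (s : Finset ι) (j : ι) (hj : j ∉ s) :
    MeasurePreserving (fun q : (ι → ℝ) × ℝ => Function.update q.1 j q.2)
      ((orthantMeasure s).prod (volume.restrict (Ici 0))) (orthantMeasure (insert j s)) := by
  have hm : Measurable (fun q : (ι → ℝ) × ℝ => Function.update q.1 j q.2) := by
    refine measurable_pi_iff.2 fun i => ?_
    by_cases h : i = j
    · subst h; simpa using measurable_snd
    · simpa [h, Function.comp_def] using (measurable_pi_apply i).comp measurable_fst
  refine ⟨hm, (Measure.pi_eq fun u hu => ?_).symm⟩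
  rw [Measure.map_apply hm (MeasurableSet.univ_pi hu)]
  have : (fun q : (ι → ℝ) × ℝ => Function.update q.1 j q.2) ⁻¹' (univ.pi u) =
      (univ.pi (Function.update u j univ)) ×ˢ u j := by
    ext ⟨t, x⟩
    simp only [mem_preimage, Set.mem_pi, mem_univ, true_imp_iff, mem_prod]
    constructor
    · intro h
      refine ⟨fun i => ?_, by simpa using h j⟩
      by_cases hi : i = j
      · subst hi; simp
      · simpa [hi] using h i
    · rintro ⟨h, hx⟩ i
      by_cases hi : i = j
      · subst hi; simpa using hx
      · simpa [hi] using h i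
  rw [this, Measure.prod_prod, orthantMeasure, Measure.pi_pi,
    ← Finset.mul_prod_erase Finset.univ _ (Finset.mem_univ j),
    ← Finset.mul_prod_erase Finset.univ (fun i => rayOrDirac (i ∈ insert j s) (u i))
      (Finset.mem_univ j), rayOrDirac_false hj,
    rayOrDirac_true (Finset.mem_insert_self j s)]
  simp only [Function.update_self, measure_univ, one_mul]
  rw [mul_comm]
  congr 1
  refine Finset.prod_congr rfl fun i hi => ?_
  have hij := Finset.ne_of_mem_erase hi
  simp [hij]

theorem integral_orthantMeasure_insert [DecidableEq ι] (s : Finset ι) (j : ι) (hj : j ∉ s)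
    {F : (ι → ℝ) → ℝ} (hF : Integrable F (orthantMeasure (insert j s))) :
    ∫ t, F t ∂orthantMeasure (insert j s) =
      ∫ t, (∫ x in Ioi (0 : ℝ), F (Function.update t j x)) ∂orthantMeasure s := by
  have h := measurePreserving_update s j hj
  rw [← h.map_eq, integral_map h.measurable.aemeasurable (by rw [h.map_eq]; exact hF.1),
    integral_prod]
  · simp_rw [integral_Ici_eq_integral_Ioi]
  · exact h.integrable_comp_of_integrable hF

omit [MeasurableSpace V] [BorelSpace V] in
theorem IsTest.comp_line {f : V → ℝ} (hf : IsTest f) (v : V) {w : V} (hw : w ≠ 0) :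
    IsTest (fun x : ℝ => f (v + x • w)) := by
  refine ⟨hf.contDiff.comp (by fun_prop), ?_⟩
  have h1 : Topology.IsClosedEmbedding (fun x : ℝ => v + x • w) :=
    (Homeomorph.addLeft v).isClosedEmbedding.comp (isClosedEmbedding_smul_left hw)
  exact hf.hasCompactSupport.comp_isClosedEmbedding h1

omit [MeasurableSpace V] [BorelSpace V] in
theorem IsTest.deriv_comp_line {f : V → ℝ} (hf : IsTest f) (v w : V) (x : ℝ) :
    deriv (fun x : ℝ => f (v + x • w)) x = Spline.dirDeriv w f (v + x • w) := by
  have h2 : HasDerivAt (fun x : ℝ => v + x • w) w x := by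
    simpa using ((hasDerivAt_id x).smul_const w).const_add v
  exact ((hf.differentiable _).hasFDerivAt.comp_hasDerivAt x h2).deriv

/-- The fundamental theorem of calculus in one coordinate: `∂_{b j} T_{s ∪ j} = T_s`. -/
theorem integral_dirDeriv_coneMeasure [DecidableEq ι] {b : ι → V} {s : Finset ι} {j : ι}
    (hj : j ∉ s) (hb : Coercive b (insert j s)) {f : V → ℝ} (hf : IsTest f) :
    ∫ x, dirDeriv (b j) f x ∂coneMeasure b (insert j s) = -∫ x, f x ∂coneMeasure b s := by
  rw [integral_coneMeasure _ _ (hf.dirDeriv _).continuous, integral_coneMeasure _ _ hf.continuous,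
    integral_orthantMeasure_insert s j hj
      (hb.integrable_comp (hf.dirDeriv _).continuous (hf.dirDeriv _).hasCompactSupport),
    ← integral_neg]
  refine integral_congr_ae ?_
  filter_upwards [ae_orthantMeasure s] with t ht
  simp only [comb_update b t j (ht.2 j hj), ← hf.deriv_comp_line]
  have hg := hf.comp_line (comb b t) (hb.ne_zero (Finset.mem_insert_self j s))
  rw [hg.hasCompactSupport.integral_Ioi_deriv_eq (hg.contDiff.of_le (by simp))]
  simp

/-- Integration by parts against a coordinate. -/
theorem integral_coord_mul_dirDeriv [DecidableEq ι] {b : ι → V} {s : Finset ι} {j : ι}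
    (hj : j ∈ s) (hb : Coercive b s) {f : V → ℝ} (hf : IsTest f) :
    Integrable (fun t => t j * dirDeriv (b j) f (comb b t)) (orthantMeasure s) ∧
    ∫ t, t j * dirDeriv (b j) f (comb b t) ∂orthantMeasure s = -∫ x, f x ∂coneMeasure b s := by
  have hint : Integrable (fun t => t j * dirDeriv (b j) f (comb b t)) (orthantMeasure s) := by
    have hd := hf.dirDeriv (b j)
    obtain ⟨M, hM0, hM⟩ := hd.exists_radius
    obtain ⟨c, hc, hct⟩ := id hb
    refine Integrable.mono' ((hb.integrable_comp hd.continuous hd.hasCompactSupport).norm.const_mul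
      (c⁻¹ * M)) ?_ ?_
    · exact (((continuous_apply j).mul
        (hd.continuous.comp (continuous_comb b)))).measurable.aestronglyMeasurable
    · filter_upwards [ae_orthantMeasure s] with t ht
      rw [norm_mul]
      -- Beyond radius `M` the derivative vanishes; within it, coercivity bounds the coordinate `t
      -- j` by `c⁻¹ * M`.
      by_cases h : M < ‖comb b t‖
      · simp [hM _ h]
      · refine mul_le_mul_of_nonneg_right ?_ (norm_nonneg _)
        rw [Real.norm_of_nonneg (ht.1 j), le_inv_mul_iff₀ hc]
        have h1 : t j ≤ ∑ j, t j := Finset.single_le_sum (fun j _ => ht.1 j) (Finset.mem_univ j)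
        nlinarith [hct t ht.1 ht.2]
  refine ⟨hint, ?_⟩
  obtain ⟨s', hj', rfl⟩ : ∃ s', j ∉ s' ∧ s = insert j s' :=
    ⟨s.erase j, by simp, (Finset.insert_erase hj).symm⟩
  rw [integral_orthantMeasure_insert s' j hj' hint, integral_coneMeasure _ _ hf.continuous,
    integral_orthantMeasure_insert s' j hj' (hb.integrable_comp hf.continuous hf.hasCompactSupport),
    ← integral_neg]
  refine integral_congr_ae ?_
  filter_upwards [ae_orthantMeasure s'] with t ht
  simp only [comb_update b t j (ht.2 j hj'), ← hf.deriv_comp_line, Function.update_self]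
  have hg := hf.comp_line (comb b t) (hb.ne_zero (Finset.mem_insert_self j s'))
  set g := fun x : ℝ => f (comb b t + x • b j)
  -- Integrating the derivative of `x * g x` over the half-line leaves no boundary term, because of
  -- the factor `x` at 0.
  have hxg : IsTest (fun x : ℝ => x * g x) := hg.mul_left contDiff_id
  have h1 := hxg.hasCompactSupport.integral_Ioi_deriv_eq (hxg.contDiff.of_le (by simp)) 0
  have h2 (x : ℝ) : deriv (fun x : ℝ => x * g x) x = g x + x * deriv g x := by
    have := (hasDerivAt_id' x).fun_mul (hg.differentiable x).hasDerivAt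
    simpa using this.deriv
  simp only [h2, zero_mul, neg_zero] at h1
  have hg' : IsTest (deriv g) :=
    ⟨hg.contDiff.iterate_deriv 1, hg.hasCompactSupport.deriv⟩
  rw [integral_add (hg.integrable _).integrableOn
    ((hg'.mul_left (p := fun x => x) contDiff_id).integrable _).integrableOn] at h1
  linarith

/-- Euler's identity: splines are homogeneous. -/
theorem integral_euler_coneMeasure {b : ι → V} {s : Finset ι} (hb : Coercive b s) {f : V → ℝ}
    (hf : IsTest f) :
    ∫ x, fderiv ℝ f x x ∂coneMeasure b s = -(s.card * ∫ x, f x ∂coneMeasure b s) := by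
  classical
  have hcont : Continuous fun x => fderiv ℝ f x x :=
    (hf.contDiff.continuous_fderiv (by simp)).clm_apply continuous_id
  rw [integral_coneMeasure _ _ hcont]
  -- Almost every `t` is supported on `s`, so the radial derivative splits into one coordinate term
  -- for each `j ∈ s`; each contributes minus the integral of `f`.
  have h1 : ∫ t, fderiv ℝ f (comb b t) (comb b t) ∂orthantMeasure s =
      ∫ t, ∑ j ∈ s, t j * dirDeriv (b j) f (comb b t) ∂orthantMeasure s := by
    refine integral_congr_ae ?_
    filter_upwards [ae_orthantMeasure s] with t ht
    have : comb b t = ∑ j ∈ s, t j • b j := by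
      unfold comb
      exact (Finset.sum_subset (Finset.subset_univ s) fun i _ hi => by simp [ht.2 i hi]).symm
    conv_lhs => rw [show fderiv ℝ f (comb b t) (comb b t) =
      fderiv ℝ f (comb b t) (∑ j ∈ s, t j • b j) by rw [← this]]
    simp [dirDeriv]
  rw [h1, integral_finsetSum _ fun j hj => (integral_coord_mul_dirDeriv hj hb hf).1,
    Finset.sum_congr rfl fun j hj => (integral_coord_mul_dirDeriv hj hb hf).2]
  simp

end Cone

/-! ### Reindexing of cone measures -/

section Reindex

variable {V ι κ : Type*} [NormedAddCommGroup V] [NormedSpace ℝ V] [Fintype ι] [Fintype κ]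

/-- The coordinates outside the range of `e` carry Dirac masses at 0, which matches extension by
zero. -/
theorem measurePreserving_extend (e : κ ↪ ι) (s : Finset κ) :
    MeasurePreserving (fun t : κ → ℝ => Function.extend e t (0 : ι → ℝ))
      (orthantMeasure s) (orthantMeasure (s.map e)) := by
  classical
  have hm : Measurable (fun t : κ → ℝ => Function.extend e t (0 : ι → ℝ)) := by
    refine measurable_pi_iff.2 fun i => ?_
    by_cases h : ∃ k, e k = i
    · obtain ⟨k, rfl⟩ := h
      simpa [e.injective.extend_apply] using measurable_pi_apply k
    · simp [Function.extend_apply' _ _ _ h]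
  refine ⟨hm, (Measure.pi_eq fun u hu => ?_).symm⟩
  rw [Measure.map_apply hm (MeasurableSet.univ_pi hu)]
  -- A box that misses 0 in some added coordinate has measure zero on both sides.
  by_cases h0 : ∀ i, i ∉ range e → (0 : ℝ) ∈ u i
  · have : (fun t : κ → ℝ => Function.extend e t (0 : ι → ℝ)) ⁻¹' (univ.pi u) =
        univ.pi fun k => u (e k) := by
      ext t
      simp only [mem_preimage, Set.mem_pi, mem_univ, true_imp_iff]
      constructor
      · intro h k
        simpa [e.injective.extend_apply] using h (e k)
      · intro h i
        by_cases hi : ∃ k, e k = i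
        · obtain ⟨k, rfl⟩ := hi
          simpa [e.injective.extend_apply] using h k
        · rw [Function.extend_apply' _ _ _ hi]
          exact h0 i hi
    rw [this, orthantMeasure, Measure.pi_pi]
    refine Fintype.prod_of_injective e e.injective _ _ (fun i hi => ?_) (fun k => by simp)
    rw [rayOrDirac_false, Measure.dirac_apply_of_mem (h0 i hi)]
    simp only [Finset.mem_map, not_exists, not_and]
    exact fun k _ hk => hi ⟨k, hk⟩
  · push Not at h0
    obtain ⟨i, hi, hu0⟩ := h0
    have : (fun t : κ → ℝ => Function.extend e t (0 : ι → ℝ)) ⁻¹' (univ.pi u) = ∅ := by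
      refine eq_empty_of_forall_notMem fun t ht => hu0 ?_
      have := ht i (mem_univ i)
      simpa [Function.extend_apply' _ _ _ hi] using this
    rw [this, measure_empty, Finset.prod_eq_zero (Finset.mem_univ i)]
    rw [rayOrDirac_false, Measure.dirac_apply' _ (hu i), indicator_of_notMem hu0]
    simp only [Finset.mem_map, not_exists, not_and]
    exact fun k _ hk => hi ⟨k, hk⟩

theorem comb_extend (a : ι → V) (e : κ ↪ ι) (t : κ → ℝ) :
    comb a (Function.extend e t 0) = comb (fun k => a (e k)) t := by
  unfold comb
  refine (Fintype.sum_of_injective e e.injective _ _ (fun i hi => ?_) (fun k => ?_)).symm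
  · rw [Function.extend_apply' _ _ _ hi]; simp
  · simp [e.injective.extend_apply]

/-- Passes between splines of lists indexed by subtypes, such as X ∩ r and X ∖ r, and sublists of
one fixed list. -/
theorem coneMeasure_map [MeasurableSpace V] [BorelSpace V] (a : ι → V) (e : κ ↪ ι)
    (s : Finset κ) : coneMeasure a (s.map e) = coneMeasure (fun k => a (e k)) s := by
  have h := measurePreserving_extend e s
  rw [coneMeasure, ← h.map_eq, Measure.map_map (continuous_comb a).measurable h.measurable,
    coneMeasure]
  congr 1
  ext t
  exact comb_extend a e t

theorem orthantMeasure_univ :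
    orthantMeasure (Finset.univ : Finset ι) = volume.restrict {t : ι → ℝ | ∀ i, 0 ≤ t i} := by
  have : {t : ι → ℝ | ∀ i, 0 ≤ t i} = univ.pi fun _ => Ici 0 := by
    ext t; simp [Pi.le_def]
  rw [this, volume_pi, Measure.restrict_pi_pi, orthantMeasure]
  simp only [rayOrDirac_true (Finset.mem_univ _)]

theorem coneMeasure_univ [MeasurableSpace V] [BorelSpace V] (b : ι → V) :
    coneMeasure b Finset.univ = splineMeasure b := by
  rw [coneMeasure, orthantMeasure_univ, splineMeasure]
  rfl

theorem Coercive.comp {a : ι → V} {e : κ ↪ ι} {s : Finset κ} (h : Coercive a (s.map e)) :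
    Coercive (fun k => a (e k)) s := by
  obtain ⟨c, hc, H⟩ := h
  refine ⟨c, hc, fun t ht ht' => ?_⟩
  have h1 := H (Function.extend e t 0) (fun i => ?_) (fun i hi => ?_)
  · rw [comb_extend] at h1
    refine le_trans (le_of_eq ?_) h1
    congr 1
    refine Fintype.sum_of_injective e e.injective _ _ (fun i hi => ?_) (fun k => ?_)
    · rw [Function.extend_apply' _ _ _ hi]; simp
    · simp [e.injective.extend_apply]
  · by_cases hi : ∃ k, e k = i
    · obtain ⟨k, rfl⟩ := hi
      simpa [e.injective.extend_apply] using ht k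
    · simp [Function.extend_apply' _ _ _ hi]
  · by_cases hi' : ∃ k, e k = i
    · obtain ⟨k, rfl⟩ := hi'
      rw [e.injective.extend_apply]
      exact ht' k fun hk => hi (Finset.mem_map_of_mem e hk)
    · simp [Function.extend_apply' _ _ _ hi']

end Reindex

/-! ### Polynomial functions -/

section Poly

variable {E : Type*} [NormedAddCommGroup E] [NormedSpace ℝ E] [FiniteDimensional ℝ E]

/-- Polynomial functions: the algebra generated by the linear forms. -/
def IsPoly (p : E → ℝ) : Prop :=
  p ∈ Algebra.adjoin ℝ (Set.range fun (l : E →ₗ[ℝ] ℝ) => (l : E → ℝ))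

omit [FiniteDimensional ℝ E] in
theorem IsPoly.linear (l : E →ₗ[ℝ] ℝ) : IsPoly (l : E → ℝ) := Algebra.subset_adjoin ⟨l, rfl⟩

omit [FiniteDimensional ℝ E] in
theorem IsPoly.const (c : ℝ) : IsPoly (fun _ : E => c) := Subalgebra.algebraMap_mem _ c

omit [FiniteDimensional ℝ E] in
theorem IsPoly.add {p q : E → ℝ} (hp : IsPoly p) (hq : IsPoly q) : IsPoly fun x => p x + q x :=
  Subalgebra.add_mem _ hp hq

omit [FiniteDimensional ℝ E] in
theorem IsPoly.mul {p q : E → ℝ} (hp : IsPoly p) (hq : IsPoly q) : IsPoly fun x => p x * q x :=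
  Subalgebra.mul_mem _ hp hq

omit [FiniteDimensional ℝ E] in
theorem IsPoly.sum {κ : Type*} (s : Finset κ) {p : κ → E → ℝ} (hp : ∀ k ∈ s, IsPoly (p k)) :
    IsPoly fun x => ∑ k ∈ s, p k x := by
  have h : ∑ k ∈ s, p k ∈ Algebra.adjoin ℝ (Set.range fun (l : E →ₗ[ℝ] ℝ) => (l : E → ℝ)) :=
    Subalgebra.sum_mem _ hp
  have h2 : (fun x => ∑ k ∈ s, p k x) = ∑ k ∈ s, p k := by
    ext x
    simp
  rw [IsPoly, h2]
  exact h

/-- Analyticity, rather than smoothness, is what the identity theorem in `IsPoly.eq_of_eqOn` needs.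
-/
theorem IsPoly.contDiff {p : E → ℝ} (hp : IsPoly p) : ContDiff ℝ ω p := by
  refine Algebra.adjoin_induction (p := fun p _ => ContDiff ℝ ω p) ?_ ?_ ?_ ?_ hp
  · rintro _ ⟨l, rfl⟩
    exact l.toContinuousLinearMap.contDiff
  · exact fun c => contDiff_const
  · exact fun p q _ _ h1 h2 => h1.add h2
  · exact fun p q _ _ h1 h2 => h1.mul h2

theorem IsPoly.smooth {p : E → ℝ} (hp : IsPoly p) : ContDiff ℝ ∞ p := hp.contDiff.of_le (by simp)

theorem IsPoly.continuous {p : E → ℝ} (hp : IsPoly p) : Continuous p := hp.smooth.continuous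

theorem IsPoly.differentiable {p : E → ℝ} (hp : IsPoly p) : Differentiable ℝ p :=
  hp.smooth.differentiable (by simp)

theorem IsPoly.dirDeriv {p : E → ℝ} (hp : IsPoly p) (v : E) : IsPoly (dirDeriv v p) := by
  refine Algebra.adjoin_induction (p := fun p _ => IsPoly (Spline.dirDeriv v p)) ?_ ?_ ?_ ?_ hp
  · rintro _ ⟨l, rfl⟩
    have : Spline.dirDeriv v (l : E → ℝ) = fun _ => l v := by
      ext x
      exact congrArg (· v) (l.toContinuousLinearMap.fderiv (x := x))
    rw [this]
    exact .const _
  · intro c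
    have : Spline.dirDeriv v (algebraMap ℝ (E → ℝ) c) = fun _ => 0 := by
      ext x
      have : algebraMap ℝ (E → ℝ) c = fun _ => c := rfl
      simp [Spline.dirDeriv, this]
    rw [this]
    exact .const _
  · intro p q hp hq h1 h2
    have : Spline.dirDeriv v (p + q) = fun x => Spline.dirDeriv v p x + Spline.dirDeriv v q x := by
      ext x
      simp [Spline.dirDeriv, fderiv_add (IsPoly.differentiable hp x) (IsPoly.differentiable hq x)]
    rw [this]
    exact h1.add h2
  · intro p q hp hq h1 h2
    have : Spline.dirDeriv v (p * q) =
        fun x => p x * Spline.dirDeriv v q x + q x * Spline.dirDeriv v p x := by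
      ext x
      simp [Spline.dirDeriv, fderiv_mul (IsPoly.differentiable hp x) (IsPoly.differentiable hq x)]
    rw [this]
    exact (IsPoly.mul hp h2).add (IsPoly.mul hq h1)

theorem IsPoly.eq_of_eqOn {p q : E → ℝ} (hp : IsPoly p) (hq : IsPoly q) {U : Set E}
    (hU : IsOpen U) (hne : U.Nonempty) (h : EqOn p q U) : p = q := by
  obtain ⟨x, hx⟩ := hne
  exact AnalyticOnNhd.eq_of_eventuallyEq (𝕜 := ℝ) hp.contDiff.analyticOnNhd
    hq.contDiff.analyticOnNhd (z₀ := x) (h.eventuallyEq_of_mem (hU.mem_nhds hx))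

variable [MeasurableSpace E] [BorelSpace E] (μ : Measure E) [IsLocallyFiniteMeasure μ]

omit [FiniteDimensional ℝ E] in
theorem IsTest.integrable_mul {p f : E → ℝ} (hp : Continuous p) (hf : IsTest f) :
    Integrable (fun x => p x * f x) μ :=
  (hp.mul hf.continuous).integrable_of_hasCompactSupport hf.hasCompactSupport.mul_left

/-- The fundamental lemma of the calculus of variations gives equality almost everywhere; continuity
and positivity of `μ` on open sets make it pointwise. -/
theorem eqOn_of_integral_eq [μ.IsOpenPosMeasure] {p q : E → ℝ} (hp : Continuous p)
    (hq : Continuous q) {U : Set E} (hU : IsOpen U)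
    (h : ∀ f, IsTest f → tsupport f ⊆ U → ∫ x, p x * f x ∂μ = ∫ x, q x * f x ∂μ) :
    EqOn p q U := by
  have h1 : ∀ᵐ x ∂μ, x ∈ U → p x - q x = 0 := by
    refine hU.ae_eq_zero_of_integral_contDiff_smul_eq_zero
      ((hp.sub hq).locallyIntegrable.locallyIntegrableOn U) fun g hg hgc hgU => ?_
    have hgt : IsTest g := ⟨hg, hgc⟩
    have := h g hgt hgU
    simp only [smul_eq_mul, mul_comm (g _), sub_mul]
    rw [integral_sub (hgt.integrable_mul μ hp) (hgt.integrable_mul μ hq), this, sub_self]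
  have h2 : p =ᵐ[μ.restrict U] q := by
    rw [Filter.EventuallyEq, ae_restrict_iff' hU.measurableSet]
    filter_upwards [h1] with x hx hxU
    linarith [hx hxU]
  exact Measure.eqOn_open_of_ae_eq h2 hU hp.continuousOn hq.continuousOn

theorem IsPoly.eq_of_integral_eq [μ.IsOpenPosMeasure] {p q : E → ℝ} (hp : IsPoly p)
    (hq : IsPoly q) {U : Set E} (hU : IsOpen U) (hne : U.Nonempty)
    (h : ∀ f, IsTest f → tsupport f ⊆ U → ∫ x, p x * f x ∂μ = ∫ x, q x * f x ∂μ) : p = q :=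
  hp.eq_of_eqOn hq hU hne (eqOn_of_integral_eq μ hp.continuous hq.continuous hU h)

omit [IsLocallyFiniteMeasure μ] in
theorem integral_mul_dirDeriv [μ.IsAddHaarMeasure] {p f : E → ℝ} (hp : ContDiff ℝ ∞ p)
    (hf : IsTest f) (v : E) :
    ∫ x, p x * dirDeriv v f x ∂μ = -∫ x, dirDeriv v p x * f x ∂μ :=
  integral_mul_fderiv_eq_neg_fderiv_mul_of_integrable
    (hf.integrable_mul μ (contDiff_dirDeriv hp v).continuous)
    ((hf.dirDeriv v).integrable_mul μ hp.continuous) (hf.integrable_mul μ hp.continuous)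
    (fun x _ => hp.differentiable (by simp) x) (fun x _ => hf.differentiable x)

end Poly

/-! ### Splines are polynomial on topes -/

section LocalPolynomial

variable {E ι : Type*} [NormedAddCommGroup E] [NormedSpace ℝ E] [Fintype ι]

/-- A set that meets no hyperplane spanned by vectors of the spanning list `a`. -/
structure AvoidsHyperplanes (a : ι → E) (U : Set E) : Prop where
  span_eq_top : Submodule.span ℝ (Set.range a) = ⊤
  notMem : ∀ s : Finset ι, IsCoatom (Submodule.span ℝ (a '' (s : Set ι))) →
    ∀ x ∈ U, x ∉ Submodule.span ℝ (a '' (s : Set ι))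

/-- Enlarge `s` to a maximal non-spanning index set: one further vector outside its span then
generates everything, so the span is covered by `⊤`. -/
theorem exists_isCoatom_span {a : ι → E} (ha : Submodule.span ℝ (Set.range a) = ⊤) {s : Finset ι}
    (hs : Submodule.span ℝ (a '' (s : Set ι)) ≠ ⊤) :
    ∃ s', s ⊆ s' ∧ IsCoatom (Submodule.span ℝ (a '' (s' : Set ι))) := by
  classical
  obtain ⟨s', hss', hmax⟩ := Finite.exists_le_maximal
    (p := fun s : Finset ι => Submodule.span ℝ (a '' (s : Set ι)) ≠ ⊤) hs
  refine ⟨s', hss', ?_⟩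
  obtain ⟨i, hi⟩ : ∃ i, a i ∉ Submodule.span ℝ (a '' (s' : Set ι)) := by
    by_contra! h
    apply hmax.prop
    rw [eq_top_iff, ← ha, Submodule.span_le]
    rintro _ ⟨i, rfl⟩
    exact h i
  have h1 : Submodule.span ℝ (a '' ((insert i s' : Finset ι) : Set ι)) = ⊤ := by
    by_contra h
    have h2 := hmax.le_of_ge h (Finset.subset_insert i s')
    exact hi (Submodule.subset_span ⟨i, h2 (Finset.mem_insert_self i s'), rfl⟩)
  rw [← covBy_top_iff, ← h1, Finset.coe_insert, image_insert_eq, Submodule.span_insert]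
  exact Submodule.covBy_span_singleton_sup hi

theorem AvoidsHyperplanes.notMem_span {a : ι → E} {U : Set E} (h : AvoidsHyperplanes a U)
    {s : Finset ι} (hs : Submodule.span ℝ (a '' (s : Set ι)) ≠ ⊤) {x : E} (hx : x ∈ U) :
    x ∉ Submodule.span ℝ (a '' (s : Set ι)) := by
  obtain ⟨s', hss', hs'⟩ := exists_isCoatom_span h.span_eq_top hs
  exact fun hxs => h.notMem s' hs' x hx
    (Submodule.span_mono (image_mono (Finset.coe_subset.2 hss')) hxs)

variable [MeasurableSpace E] [BorelSpace E]

theorem AvoidsHyperplanes.integral_eq_zero {a : ι → E} {U : Set E} (h : AvoidsHyperplanes a U)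
    {s : Finset ι} (hs : Submodule.span ℝ (a '' (s : Set ι)) ≠ ⊤) {f : E → ℝ}
    (hf : Continuous f) (hfU : tsupport f ⊆ U) : ∫ x, f x ∂coneMeasure a s = 0 := by
  refine integral_coneMeasure_eq_zero a s hf fun t _ ht => ?_
  by_contra hne
  exact h.notMem_span hs (hfU (subset_tsupport _ hne)) (comb_mem_span a s ht)

variable [FiniteDimensional ℝ E] (μ : Measure E) [μ.IsAddHaarMeasure]

/-- The coordinate isomorphism carries Lebesgue measure to a Haar measure, which is unique up to a
factor. -/
theorem exists_coneMeasure_basis {κ : Type*} [Fintype κ] (B : Module.Basis κ ℝ E) :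
    ∃ c : ENNReal, c ≠ ⊤ ∧ coneMeasure B Finset.univ =
      c • μ.restrict {x | ∀ k, 0 ≤ B.coord k x} := by
  let Φ : (κ → ℝ) ≃L[ℝ] E := B.equivFun.symm.toContinuousLinearEquiv
  have hΦ : ∀ t, Φ t = comb B t := fun t => B.equivFun_symm_apply t
  have : (Measure.map Φ (volume : Measure (κ → ℝ))).IsAddHaarMeasure :=
    Φ.isAddHaarMeasure_map _
  refine ⟨Measure.addHaarScalarFactor (Measure.map Φ volume) μ, ENNReal.coe_ne_top, ?_⟩
  have hset : MeasurableSet {x | ∀ k, 0 ≤ B.coord k x} := by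
    have : {x | ∀ k, 0 ≤ B.coord k x} = ⋂ k, {x | 0 ≤ B.coord k x} := by ext; simp
    rw [this]
    refine MeasurableSet.iInter fun k => ?_
    exact (isClosed_le continuous_const
      (B.coord k).toContinuousLinearMap.continuous).measurableSet
  have h1 : coneMeasure B Finset.univ =
      (Measure.map Φ volume).restrict {x | ∀ k, 0 ≤ B.coord k x} := by
    rw [Measure.restrict_map Φ.continuous.measurable hset, coneMeasure, orthantMeasure_univ]
    have hΦ' : (Φ : (κ → ℝ) → E) = comb B := funext hΦ
    have hpre : Φ ⁻¹' {x | ∀ k, 0 ≤ B.coord k x} = {t : κ → ℝ | ∀ i, 0 ≤ t i} := by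
      ext t
      have (k : κ) : B.coord k (Φ t) = t k := congrFun (B.equivFun.apply_symm_apply t) k
      simp only [mem_preimage, mem_ofPred_eq, this]
    rw [hpre, hΦ']
  conv_lhs => rw [h1, Measure.isAddLeftInvariant_eq_smul (Measure.map Φ volume) μ]
  rw [Measure.restrict_smul]
  rfl

/-- A coordinate in the basis `s` vanishes only on the span of the other vectors, which `U` avoids.
By connectedness its sign is constant on `U`, so `U` lies inside the simplicial cone or misses it.
-/
theorem AvoidsHyperplanes.exists_const {a : ι → E} {U : Set E} (h : AvoidsHyperplanes a U)
    (hU : IsPreconnected U) {s : Finset ι}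
    (hli : LinearIndependent ℝ fun i : s => a i)
    (hs : Submodule.span ℝ (a '' (s : Set ι)) = ⊤) :
    ∃ c : ℝ, ∀ f : E → ℝ, Continuous f → tsupport f ⊆ U →
      ∫ x, f x ∂coneMeasure a s = ∫ x, c * f x ∂μ := by
  classical
  have hrange : Set.range (fun i : s => a i) = a '' (s : Set ι) := by
    ext x; simp
  let B : Module.Basis s ℝ E := Module.Basis.mk hli (by rw [hrange, hs])
  have hB : (B : s → E) = fun i : s => a i := Module.Basis.coe_mk _ _
  obtain ⟨c, hc, hcone⟩ := exists_coneMeasure_basis μ B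
  have h1 : coneMeasure a s = c • μ.restrict {x | ∀ k, 0 ≤ B.coord k x} := by
    rw [← hcone, hB]
    have := coneMeasure_map a (Function.Embedding.subtype (· ∈ s)) Finset.univ
    rwa [Finset.univ_eq_attach, Finset.attach_map_val] at this
  have hcont (k : s) : Continuous (B.coord k) := (B.coord k).toContinuousLinearMap.continuous
  have hnz (k : s) : ∀ x ∈ U, B.coord k x ≠ 0 := by
    intro x hx h0
    refine h.notMem_span (s := s.erase k) ?_ hx ?_
    · intro htop
      have h2 : a k ∈ Submodule.span ℝ (a '' ((s.erase k : Finset ι) : Set ι)) := by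
        rw [htop]; trivial
      have h3 := hli.notMem_span_image (s := {i | i ≠ k}) (x := k) (by simp)
      apply h3
      convert h2 using 2
      ext y
      simp only [mem_image, Finset.coe_erase]
      constructor
      · rintro ⟨i, hi, rfl⟩
        exact ⟨i, ⟨i.2, fun h => hi (Subtype.ext h)⟩, rfl⟩
      · rintro ⟨i, hi, rfl⟩
        exact ⟨⟨i, hi.1⟩, fun h => hi.2 (congrArg Subtype.val h), rfl⟩
    · rw [← B.sum_repr x]
      refine Submodule.sum_mem _ fun i _ => ?_
      by_cases hik : i = k
      · subst hik
        have : B.repr x i = 0 := h0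
        rw [this, zero_smul]
        exact Submodule.zero_mem _
      · refine Submodule.smul_mem _ _ (Submodule.subset_span ⟨i, ?_, by rw [hB]⟩)
        simp only [Finset.coe_erase, Set.mem_sdiff]
        exact ⟨i.2, fun h => hik (Subtype.ext h)⟩
  by_cases hex : ∃ x ∈ U, ∀ k, 0 ≤ B.coord k x
  · obtain ⟨x, hx, hx0⟩ := hex
    have hsub : U ⊆ {x | ∀ k, 0 ≤ B.coord k x} := by
      intro y hy k
      by_contra! hneg
      obtain ⟨z, hz, hz0⟩ := hU.intermediate_value hy hx (hcont k).continuousOn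
        ⟨hneg.le, hx0 k⟩
      exact hnz k z hz hz0
    refine ⟨c.toReal, fun f hf hfU => ?_⟩
    rw [h1, integral_smul_measure, setIntegral_eq_integral_of_forall_compl_eq_zero, smul_eq_mul,
      integral_const_mul]
    exact fun x hx => image_eq_zero_of_notMem_tsupport fun h => hx (hsub (hfU h))
  · push Not at hex
    refine ⟨0, fun f hf hfU => ?_⟩
    rw [h1, integral_smul_measure, setIntegral_eq_zero_of_forall_eq_zero]
    · simp
    · intro x hx
      refine image_eq_zero_of_notMem_tsupport fun h => ?_
      obtain ⟨k, hk⟩ := hex x (hfU h)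
      exact absurd (hx k) (not_le.2 hk)

omit [MeasurableSpace E] [BorelSpace E] in
-- Leibniz rule in each coordinate: ∂_k (x_k f) = f + x_k ∂_k f. In this form the derivatives can be
-- moved onto the spline.
theorem fderiv_apply_self_eq_sum {κ : Type*} [Fintype κ] (B : Module.Basis κ ℝ E) {f : E → ℝ}
    (hf : Differentiable ℝ f) (x : E) :
    fderiv ℝ f x x = ∑ k, (dirDeriv (B k) (fun x => B.coord k x * f x) x - f x) := by
  have h1 (k : κ) : dirDeriv (B k) (fun x => B.coord k x * f x) x - f x =
      B.coord k x * fderiv ℝ f x (B k) := by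
    have h2 : HasFDerivAt (fun x => B.coord k x) (B.coord k).toContinuousLinearMap x :=
      (B.coord k).toContinuousLinearMap.hasFDerivAt
    have h3 := (h2.fun_mul (hf x).hasFDerivAt).fderiv
    rw [dirDeriv, h3]
    simp [mul_comm]
  calc fderiv ℝ f x x = fderiv ℝ f x (∑ k, B.repr x k • B k) := by rw [B.sum_repr]
    _ = _ := by rw [Finset.sum_congr rfl fun k _ => h1 k, map_sum]; simp

/-- Euler's identity contributes the factor `s.card`, the Leibniz rule removes one copy of the
integral for each basis vector, and the remaining derivatives delete vectors from the list. -/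
theorem integral_coneMeasure_recursion {a : ι → E} {s B : Finset ι} [DecidableEq ι]
    (hb : Coercive a s) (hBs : B ⊆ s) (bas : Module.Basis B ℝ E) (hbas : ∀ i : B, bas i = a i)
    {f : E → ℝ} (hf : IsTest f) :
    ((s.card : ℝ) - B.card) * ∫ x, f x ∂coneMeasure a s =
      ∑ i : B, ∫ x, bas.coord i x * f x ∂coneMeasure a (s.erase i) := by
  have := hb.isLocallyFiniteMeasure
  have h1 := integral_euler_coneMeasure hb hf
  have hsm (i : B) : IsTest fun x => bas.coord i x * f x :=
    hf.mul_left (bas.coord i).toContinuousLinearMap.contDiff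
  simp_rw [fderiv_apply_self_eq_sum bas hf.differentiable] at h1
  rw [integral_finsetSum Finset.univ (f := fun i x =>
    dirDeriv (bas i) (fun x => bas.coord i x * f x) x - f x)
    fun i _ => (((hsm i).dirDeriv _).integrable _).sub (hf.integrable _)] at h1
  have h2 (i : B) : ∫ x, (dirDeriv (bas i) (fun x => bas.coord i x * f x) x - f x)
      ∂coneMeasure a s = -∫ x, bas.coord i x * f x ∂coneMeasure a (s.erase i) -
        ∫ x, f x ∂coneMeasure a s := by
    rw [integral_sub (((hsm i).dirDeriv _).integrable _) (hf.integrable _), hbas]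
    congr 1
    have hi := Finset.insert_erase (hBs i.2)
    have := integral_dirDeriv_coneMeasure (s := s.erase i) (j := i) (b := a) (by simp)
      (by rwa [hi]) (hsm i)
    rwa [hi] at this
  simp_rw [h2] at h1
  rw [Finset.sum_sub_distrib, Finset.sum_neg_distrib] at h1
  rw [Finset.sum_const, Finset.card_univ, Fintype.card_coe, nsmul_eq_mul] at h1
  linarith

/-- A non-spanning list gives 0 on `U` and a basis gives a constant. Otherwise a basis `B` is a
proper sublist, the factor `s.card - B.card` is nonzero, and the recursion reduces to shorter lists.
-/
theorem AvoidsHyperplanes.exists_isPoly {a : ι → E} {U : Set E} (h : AvoidsHyperplanes a U)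
    (hU : IsPreconnected U) (s : Finset ι) (hb : Coercive a s) :
    ∃ p : E → ℝ, IsPoly p ∧ ∀ f : E → ℝ, IsTest f → tsupport f ⊆ U →
      ∫ x, f x ∂coneMeasure a s = ∫ x, p x * f x ∂μ := by
  classical
  induction s using Finset.strongInduction with
  | H s ih =>
  by_cases hs : Submodule.span ℝ (a '' (s : Set ι)) = ⊤
  swap
  · exact ⟨fun _ => 0, .const 0, fun f hf hfU => by
      simp [h.integral_eq_zero hs hf.continuous hfU]⟩
  obtain ⟨B, hBs, hBspan, hBli⟩ : ∃ B : Finset ι, B ⊆ s ∧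
      Submodule.span ℝ (a '' (B : Set ι)) = ⊤ ∧ LinearIndependent ℝ fun i : B => a i := by
    obtain ⟨b, hbs, -, hb1, hb2⟩ := exists_linearIndepOn_extension (K := ℝ) (v := a)
      (linearIndepOn_empty ℝ a) (empty_subset (s : Set ι))
    lift b to Finset ι using s.finite_toSet.subset hbs
    refine ⟨b, Finset.coe_subset.1 hbs, ?_, hb2⟩
    rw [eq_top_iff, ← hs, Submodule.span_le]
    exact hb1
  by_cases hBeq : B = s
  · subst hBeq
    obtain ⟨c, hc⟩ := h.exists_const μ hU hBli hBspan
    exact ⟨fun _ => c, .const c, fun f hf hfU => hc f hf.continuous hfU⟩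
  have hrange : Set.range (fun i : B => a i) = a '' (B : Set ι) := by
    ext x; simp
  let bas : Module.Basis B ℝ E := Module.Basis.mk hBli (by rw [hrange, hBspan])
  have hbas (i : B) : bas i = a i := by simp [bas]
  choose p hp hpf using fun i : B => ih (s.erase i) (Finset.erase_ssubset (hBs i.2))
    (hb.mono (Finset.erase_subset _ _))
  have hcard : ((s.card : ℝ) - B.card) ≠ 0 := by
    have := Finset.card_lt_card (hBs.ssubset_of_ne hBeq)
    have : (B.card : ℝ) < s.card := by exact_mod_cast this
    linarith
  have hlin (i : B) : IsPoly fun x => bas.coord i x := .linear _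
  refine ⟨fun x => ((s.card : ℝ) - B.card)⁻¹ * ∑ i, p i x * bas.coord i x,
    (IsPoly.const _).mul (.sum _ fun i _ => (hp i).mul (hlin i)), fun f hf hfU => ?_⟩
  have h2 := integral_coneMeasure_recursion hb hBs bas hbas hf
  rw [← eq_inv_mul_iff_mul_eq₀ hcard] at h2
  rw [h2]
  simp_rw [mul_assoc, Finset.sum_mul]
  rw [integral_const_mul, integral_finsetSum]
  · congr 1
    refine Finset.sum_congr rfl fun i _ => ?_
    rw [hpf i _ (hf.mul_left (hlin i).smooth) ((tsupport_mul_subset_right).trans hfU)]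
    simp_rw [mul_assoc]
  · intro i _
    exact hf.integrable_mul μ ((hp i).mul (hlin i)).continuous

end LocalPolynomial

/-! ### The local polynomials of a spline -/

section LocPoly

variable {E ι : Type*} [NormedAddCommGroup E] [NormedSpace ℝ E] [Fintype ι]
  [MeasurableSpace E] [BorelSpace E]

/-- `p` is a polynomial whose density with respect to `μ` coincides on `U` with the spline of the
sublist `s` of `a`. -/
def IsLocPoly (μ : Measure E) (a : ι → E) (U : Set E) (s : Finset ι) (p : E → ℝ) : Prop :=
  IsPoly p ∧ ∀ f : E → ℝ, IsTest f → tsupport f ⊆ U →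
    ∫ x, f x ∂coneMeasure a s = ∫ x, p x * f x ∂μ

open Classical in
/-- The polynomial that coincides on `U` with the spline of the sublist `s` of `a`. -/
def locPoly (μ : Measure E) (a : ι → E) (U : Set E) (s : Finset ι) : E → ℝ :=
  if h : ∃ p, IsLocPoly μ a U s p then h.choose else 0

/-- A nonempty connected open set that meets no hyperplane spanned by vectors of `a`. -/
structure IsChamber (a : ι → E) (U : Set E) : Prop extends AvoidsHyperplanes a U where
  isOpen : IsOpen U
  isPreconnected : IsPreconnected U
  nonempty : U.Nonempty

variable [FiniteDimensional ℝ E] {μ : Measure E} [μ.IsAddHaarMeasure] {a : ι → E} {U : Set E}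

theorem IsChamber.isLocPoly (h : IsChamber a U) {s : Finset ι} (hs : Coercive a s) :
    IsLocPoly μ a U s (locPoly μ a U s) := by
  have : ∃ p, IsLocPoly μ a U s p := h.exists_isPoly μ h.isPreconnected s hs
  rw [locPoly, dif_pos this]
  exact this.choose_spec

theorem IsLocPoly.eq (h : IsChamber a U) {s : Finset ι} {p q : E → ℝ}
    (hp : IsLocPoly μ a U s p) (hq : IsLocPoly μ a U s q) : p = q :=
  hp.1.eq_of_integral_eq μ hq.1 h.isOpen h.nonempty fun f hf hfU => by
    rw [← hp.2 f hf hfU, ← hq.2 f hf hfU]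

theorem IsChamber.locPoly_eq_zero (h : IsChamber a U) {s : Finset ι} (hs : Coercive a s)
    (hspan : Submodule.span ℝ (a '' (s : Set ι)) ≠ ⊤) : locPoly μ a U s = 0 :=
  (h.isLocPoly (μ := μ) hs).eq h ⟨.const 0, fun f hf hfU => by
    simp [h.integral_eq_zero hspan hf.continuous hfU]⟩

/-- Both polynomials represent on `U` the derivative of the spline, so uniqueness of the local
polynomial applies. -/
theorem IsChamber.dirDeriv_locPoly [DecidableEq ι] (h : IsChamber a U) {s : Finset ι}
    (hs : Coercive a s) {j : ι} (hj : j ∈ s) :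
    dirDeriv (a j) (locPoly μ a U s) = locPoly μ a U (s.erase j) := by
  have hp := h.isLocPoly (μ := μ) hs
  refine IsLocPoly.eq h ⟨hp.1.dirDeriv _, fun f hf hfU => ?_⟩
    (h.isLocPoly (μ := μ) (hs.mono (Finset.erase_subset j s)))
  have h1 := hp.2 _ (hf.dirDeriv (a j)) ((tsupport_dirDeriv_subset _ _).trans hfU)
  rw [integral_mul_dirDeriv μ hp.1.smooth hf] at h1
  have hi := Finset.insert_erase hj
  have h2 := integral_dirDeriv_coneMeasure (b := a) (s := s.erase j) (j := j) (by simp)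
    (by rwa [hi]) hf
  rw [hi] at h2
  linarith

end LocPoly

/-! ### Correlation of a test function with a measure -/

section ShiftInt

variable {E : Type*} [NormedAddCommGroup E] [NormedSpace ℝ E] [FiniteDimensional ℝ E]
  [MeasurableSpace E] [BorelSpace E]

/-- The function `y ↦ ∫ f (x + y) dμ(x)`. -/
def shiftInt (μ : Measure E) (f : E → ℝ) (y : E) : ℝ := ∫ x, f (x + y) ∂μ

variable (μ : Measure E) [IsLocallyFiniteMeasure μ] {f g : E → ℝ}

/-- The correlation is the convolution of the constant 1, taken against the reflected measure, with
`f`. -/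
theorem IsTest.contDiff_shiftInt (hf : IsTest f) : ContDiff ℝ ∞ (shiftInt μ f) := by
  have hneg : IsLocallyFiniteMeasure (μ.map (Homeomorph.neg E)) :=
    have := Measure.IsFiniteMeasureOnCompacts.map μ (Homeomorph.neg E)
    isLocallyFiniteMeasure_of_isFiniteMeasureOnCompacts
  have h := hf.hasCompactSupport.contDiff_convolution_right (μ := μ.map (Homeomorph.neg E))
    (f := fun _ : E => (1 : ℝ)) (ContinuousLinearMap.mul ℝ ℝ) (n := ⊤)
    (locallyIntegrable_const 1) hf.contDiff
  convert h using 1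
  ext y
  rw [convolution_def, (Homeomorph.neg E).measurableEmbedding.integral_map]
  simp [shiftInt, add_comm]

omit [FiniteDimensional ℝ E] in
theorem shiftInt_add (hf : IsTest f) (hg : IsTest g) (y : E) :
    shiftInt μ (fun x => f x + g x) y = shiftInt μ f y + shiftInt μ g y :=
  integral_add ((hf.translate y).integrable μ) ((hg.translate y).integrable μ)

omit [NormedSpace ℝ E] [FiniteDimensional ℝ E] [BorelSpace E] [IsLocallyFiniteMeasure μ] in
theorem shiftInt_const_mul (c : ℝ) (f : E → ℝ) (y : E) :
    shiftInt μ (fun x => c * f x) y = c * shiftInt μ f y :=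
  integral_const_mul _ _

omit [FiniteDimensional ℝ E] [NormedSpace ℝ E] [BorelSpace E] in
theorem abs_integral_le_of_support {f : E → ℝ} {B : Set E} (hB : IsCompact B)
    {S : ℝ} (h0 : ∀ x, x ∉ B → f x = 0) (hS : ∀ x, |f x| ≤ S) :
    |∫ x, f x ∂μ| ≤ S * μ.real B := by
  rw [← setIntegral_eq_integral_of_forall_compl_eq_zero h0]
  have := norm_setIntegral_le_of_norm_le_const (μ := μ) (f := f) (C := S) hB.measure_lt_top
    fun x _ => hS x
  exact this

theorem dirDeriv_shiftInt (hf : IsTest f) (v : E) :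
    dirDeriv v (shiftInt μ f) = shiftInt μ (dirDeriv v f) := by
  ext y₀
  obtain ⟨M, hM0, hM⟩ := (hf.dirDeriv v).exists_radius
  obtain ⟨C, hC0, hC⟩ := (hf.dirDeriv v).exists_bound
  -- For `|s| < 1` and `x` outside `B`, the point `x + (y₀ + s • v)` has norm greater than `M`;
  -- hence the constant `C` on `B` dominates all derivatives.
  set B := Metric.closedBall (0 : E) (M + (‖y₀‖ + ‖v‖)) with hBdef
  have hB : IsCompact B := isCompact_closedBall _ _
  have hline (x : E) (s : ℝ) :
      HasDerivAt (fun s : ℝ => f (x + (y₀ + s • v))) (dirDeriv v f (x + (y₀ + s • v))) s := by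
    have h2 : HasDerivAt (fun s : ℝ => x + (y₀ + s • v)) v s := by
      simpa using (((hasDerivAt_id s).smul_const v).const_add y₀).const_add x
    exact (hf.differentiable _).hasFDerivAt.comp_hasDerivAt s h2
  have h1 := (hasDerivAt_integral_of_dominated_loc_of_deriv_le (μ := μ) (𝕜 := ℝ)
    (F := fun s x => f (x + (y₀ + s • v))) (x₀ := 0) (s := Metric.ball 0 1)
    (F' := fun s x => dirDeriv v f (x + (y₀ + s • v))) (bound := B.indicator fun _ => C)
    (Metric.ball_mem_nhds _ one_pos)
    (.of_forall fun s => ((hf.translate _).integrable μ).1)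
    ((hf.translate _).integrable μ) (((hf.dirDeriv v).translate _).integrable μ).1
    (.of_forall fun x s hs => ?_)
    ((integrable_indicator_iff hB.measurableSet).2 (integrableOn_const hB.measure_ne_top))
    (.of_forall fun x s _ => hline x s)).2
  · have h3 : HasDerivAt (fun s : ℝ => y₀ + s • v) v 0 := by
      simpa using ((hasDerivAt_id (0 : ℝ)).smul_const v).const_add y₀
    have h4 : HasFDerivAt (shiftInt μ f) (fderiv ℝ (shiftInt μ f) y₀) (y₀ + (0 : ℝ) • v) := by
      simpa using ((hf.contDiff_shiftInt μ).differentiable (by simp) y₀).hasFDerivAt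
    have h5 := h4.comp_hasDerivAt (0 : ℝ) h3
    have h6 := HasDerivAt.unique (f := fun s : ℝ => shiftInt μ f (y₀ + s • v)) h5 h1
    simp only [zero_smul, add_zero] at h6
    exact h6
  · by_cases hx : x ∈ B
    · rw [indicator_of_mem hx]
      exact hC _
    · rw [indicator_of_notMem hx, hM, norm_zero]
      have hs' : |s| < 1 := by simpa using hs
      have hx' : M + (‖y₀‖ + ‖v‖) < ‖x‖ := by simpa [B] using hx
      have h1 : ‖y₀ + s • v‖ ≤ ‖y₀‖ + ‖v‖ := by
        refine (norm_add_le _ _).trans ?_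
        rw [norm_smul, Real.norm_eq_abs]
        nlinarith [norm_nonneg v]
      have h2 := norm_sub_le (x + (y₀ + s • v)) (y₀ + s • v)
      rw [add_sub_cancel_right] at h2
      linarith

omit μ [IsLocallyFiniteMeasure μ] in
/-- Translation differences are derivatives. -/
theorem IsTest.exists_dirDeriv_eq (hf : IsTest f) (v : E) :
    ∃ G, IsTest G ∧ ∀ x, Spline.dirDeriv v G x = f (x + v) - f x := by
  -- The primitive is G(x) = ∫₀¹ f(x + t v) dt. As a correlation with the segment measure `ν` it
  -- inherits smoothness and the derivative rule.
  set ν : Measure E := (volume.restrict (Icc (0 : ℝ) 1)).map (fun t : ℝ => t • v) with hν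
  have hm : Measurable (fun t : ℝ => t • v) := (continuous_id.smul continuous_const).measurable
  have hfin : IsFiniteMeasure ν := by rw [hν]; infer_instance
  have hint (g : E → ℝ) (hg : Continuous g) (y : E) :
      shiftInt ν g y = ∫ t in (0 : ℝ)..1, g (y + t • v) := by
    rw [intervalIntegral.integral_of_le zero_le_one, ← integral_Icc_eq_integral_Ioc, shiftInt, hν,
      integral_map (φ := fun t : ℝ => t • v) (f := fun x => g (x + y)) hm.aemeasurable
        (hg.comp (continuous_add_const y)).measurable.aestronglyMeasurable]
    simp [add_comm]
  refine ⟨shiftInt ν f, ⟨hf.contDiff_shiftInt ν, ?_⟩, fun x => ?_⟩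
  · obtain ⟨M, hM0, hM⟩ := hf.exists_radius
    refine HasCompactSupport.intro (isCompact_closedBall (0 : E) (M + ‖v‖)) fun x hx => ?_
    rw [hint f hf.continuous, intervalIntegral.integral_congr (g := fun _ => 0)]
    · simp
    · intro t ht
      rw [uIcc_of_le zero_le_one] at ht
      refine hM _ ?_
      have hx' : M + ‖v‖ < ‖x‖ := by simpa using hx
      have h1 : ‖t • v‖ ≤ ‖v‖ := by
        rw [norm_smul, Real.norm_of_nonneg ht.1]
        nlinarith [norm_nonneg v, ht.2]
      have h2 := norm_sub_le (x + t • v) (t • v)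
      rw [add_sub_cancel_right] at h2
      linarith
  · rw [dirDeriv_shiftInt ν hf, hint _ (hf.dirDeriv v).continuous]
    have h1 (t : ℝ) : HasDerivAt (fun t : ℝ => f (x + t • v)) (Spline.dirDeriv v f (x + t • v)) t := by
      have h2 : HasDerivAt (fun t : ℝ => x + t • v) v t := by
        simpa using ((hasDerivAt_id t).smul_const v).const_add x
      exact (hf.differentiable _).hasFDerivAt.comp_hasDerivAt t h2
    rw [intervalIntegral.integral_eq_sub_of_hasDerivAt fun t _ => h1 t]
    · simp
    · exact ((hf.dirDeriv v).continuous.comp (by fun_prop)).intervalIntegrable _ _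

end ShiftInt

/-! ### Distributions defined by bounds of order zero -/

section DistrOfBound

variable {E : Type*} [NormedAddCommGroup E] [NormedSpace ℝ E]

theorem continuous_of_bound (L : Test E →ₗ[ℝ] ℝ)
    (hL : ∀ M : ℝ, ∃ C : ℝ, ∀ f : Test E, (∀ x, M < ‖x‖ → f x = 0) → ∀ S : ℝ,
      (∀ x, |f x| ≤ S) → |L f| ≤ C * S)
    (K : Compacts E) (hK : (K : Set E) ⊆ (⊤ : Opens E)) :
    Continuous (L ∘ TestFunction.ofSupportedIn hK) := by
  let L' : ContDiffMapSupportedIn E ℝ ⊤ K →ₗ[ℝ] ℝ :=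
    { toFun f := L (TestFunction.ofSupportedIn hK f)
      map_add' f g := map_add L (TestFunction.ofSupportedIn hK f) (TestFunction.ofSupportedIn hK g)
      map_smul' c f := map_smul L c (TestFunction.ofSupportedIn hK f) }
  obtain ⟨M, hM⟩ := K.isCompact.isBounded.exists_norm_le
  obtain ⟨C, hC⟩ := hL M
  refine WithSeminorms.continuous_normedSpace_rng ℝ
    (ContDiffMapSupportedIn.withSeminorms ℝ E ℝ ⊤ K) L' ⟨{0}, ⟨|C|, abs_nonneg C⟩, fun f => ?_⟩
  have hbound (x : E) : |f x| ≤ ContDiffMapSupportedIn.seminorm ℝ E ℝ ⊤ K 0 f := by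
    have := ContDiffMapSupportedIn.norm_iteratedFDeriv_apply_le_seminorm_top ℝ (i := 0) (f := f)
      (x := x)
    simpa using this
  have h1 := hC (TestFunction.ofSupportedIn hK f)
    (fun x hx => f.zero_on_compl (x := x) fun hxK => absurd (hM x hxK) (not_le.2 hx)) _ hbound
  have h0 := (abs_nonneg _).trans (hbound 0)
  rw [Finset.sup_singleton]
  change |L (TestFunction.ofSupportedIn hK f)| ≤ |C| * _
  exact h1.trans (mul_le_mul_of_nonneg_right (le_abs_self C) h0)

/-- The distribution given by a linear form on test functions that satisfies bounds of order
zero. -/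
def distrOfBound (L : Test E →ₗ[ℝ] ℝ)
    (hL : ∀ M : ℝ, ∃ C : ℝ, ∀ f : Test E, (∀ x, M < ‖x‖ → f x = 0) → ∀ S : ℝ,
      (∀ x, |f x| ≤ S) → |L f| ≤ C * S) : Distr E where
  toFun := L
  map_add' := map_add L
  map_smul' := map_smul L
  cont := (TestFunction.mkCLM ℝ L (map_add L) (map_smul L) (continuous_of_bound L hL)).continuous

end DistrOfBound

/-! ### Convolution of a cone measure with a density on a transversal subspace -/

section Conv

variable {V ι : Type*} [NormedAddCommGroup V] [InnerProductSpace ℝ V] [FiniteDimensional ℝ V]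
  [MeasurableSpace V] [BorelSpace V] [Fintype ι]

omit [FiniteDimensional ℝ V] in
-- If the integrand is nonzero at `t`, then `‖comb b t + y‖ ≤ M` and `|⟪w, y⟫| ≤ 1` bound `⟪w, comb
-- b t⟫`, hence the sum of the `t i`, hence `‖y‖`. A slab is used instead of the hyperplane
-- orthogonal to `w` so that the vanishing holds on a neighbourhood of the points of `r`; `R`
-- depends only on `M`, which gives uniform bounds.
theorem exists_shiftInt_eq_zero {b : ι → V} {s : Finset ι} {w : V}
    (hw : ∀ i ∈ s, 0 < ⟪w, b i⟫) (M : ℝ) :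
    ∃ R : ℝ, ∀ f : V → ℝ, Continuous f → (∀ x, M < ‖x‖ → f x = 0) →
      ∀ y, |⟪w, y⟫| ≤ 1 → R < ‖y‖ → shiftInt (coneMeasure b s) f y = 0 := by
  obtain ⟨c, hc, hct⟩ := coercive_of_inner hw
  set A := ∑ i, ‖b i‖
  have hA : 0 ≤ A := Finset.sum_nonneg fun i _ => norm_nonneg _
  refine ⟨M + c⁻¹ * (‖w‖ * M + 1) * A, fun f hf hM y hy hR => ?_⟩
  refine integral_coneMeasure_eq_zero b s (hf.comp (continuous_add_const y)) fun t ht ht' => ?_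
  by_contra hne
  have hle : ‖comb b t + y‖ ≤ M := by
    by_contra hlt
    exact hne (hM _ (not_le.1 hlt))
  have h1 : ∑ i, t i ≤ c⁻¹ * (‖w‖ * M + 1) := by
    rw [le_inv_mul_iff₀ hc]
    refine (hct t ht ht').trans ?_
    have h2 : ⟪w, comb b t⟫ = ⟪w, comb b t + y⟫ - ⟪w, y⟫ := by rw [inner_add_right]; ring
    have h3 := (real_inner_le_norm w (comb b t + y)).trans
      (mul_le_mul_of_nonneg_left hle (norm_nonneg w))
    have h4 := neg_abs_le ⟪w, y⟫
    linarith
  have h2 : ‖comb b t‖ ≤ (∑ i, t i) * A := by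
    refine (norm_sum_le _ _).trans ?_
    rw [Finset.sum_mul]
    refine Finset.sum_le_sum fun i _ => ?_
    rw [norm_smul, Real.norm_of_nonneg (ht i)]
    exact mul_le_mul_of_nonneg_left
      (Finset.single_le_sum (fun i _ => norm_nonneg (b i)) (Finset.mem_univ i)) (ht i)
  have h3 : ‖y‖ ≤ ‖comb b t + y‖ + ‖comb b t‖ := by
    have := norm_sub_le (comb b t + y) (comb b t)
    rwa [add_sub_cancel_left] at this
  have h4 := mul_le_mul_of_nonneg_right h1 hA
  linarith

variable {b : ι → V} {s : Finset ι} {w : V} {r : Submodule ℝ V}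

theorem IsTest.shiftInt_restrict {f : V → ℝ} (hf : IsTest f) (hw : ∀ i ∈ s, 0 < ⟪w, b i⟫)
    (hwr : w ∈ rᗮ) : IsTest (fun y : r => shiftInt (coneMeasure b s) f y) := by
  have := (Coercive.of_inner hw).isLocallyFiniteMeasure
  obtain ⟨M, hM0, hM⟩ := hf.exists_radius
  obtain ⟨R, hR⟩ := exists_shiftInt_eq_zero hw M
  refine ⟨(hf.contDiff_shiftInt _).comp r.subtypeL.contDiff,
    HasCompactSupport.intro (isCompact_closedBall (0 : r) R) fun y hy => ?_⟩
  refine hR f hf.continuous hM y ?_ (by simpa using hy)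
  rw [Submodule.inner_left_of_mem_orthogonal y.2 hwr]
  simp

/-- The value on `f` of `c T * (p dx)`, where `T` is integration against a cone measure and `p` is
a function on `r`. -/
def convValue (c : ℝ) (b : ι → V) (s : Finset ι) (r : Submodule ℝ V) (p : r → ℝ) (f : V → ℝ) : ℝ :=
  c * ∫ y : r, p y * shiftInt (coneMeasure b s) f y

theorem convValue_add (c : ℝ) {p : r → ℝ} (hp : Continuous p) (hw : ∀ i ∈ s, 0 < ⟪w, b i⟫)
    (hwr : w ∈ rᗮ) {f g : V → ℝ} (hf : IsTest f) (hg : IsTest g) :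
    convValue c b s r p (fun x => f x + g x) = convValue c b s r p f + convValue c b s r p g := by
  have := (Coercive.of_inner hw).isLocallyFiniteMeasure
  unfold convValue
  simp_rw [shiftInt_add _ hf hg, mul_add]
  rw [integral_add ((hf.shiftInt_restrict hw hwr).integrable_mul _ hp)
    ((hg.shiftInt_restrict hw hwr).integrable_mul _ hp), mul_add]

theorem convValue_const_mul (c : ℝ) (p : r → ℝ) (k : ℝ) (f : V → ℝ) :
    convValue c b s r p (fun x => k * f x) = k * convValue c b s r p f := by
  unfold convValue
  simp_rw [shiftInt_const_mul, mul_left_comm _ k, integral_const_mul]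
  ring

/-- For `f` supported in radius `M`, only `y` with norm at most `R` and `x` with norm at most `M +
R` contribute, so everything is integrated over fixed balls. -/
theorem exists_convValue_bound (c : ℝ) {p : r → ℝ} (hp : Continuous p)
    (hw : ∀ i ∈ s, 0 < ⟪w, b i⟫) (hwr : w ∈ rᗮ) (M : ℝ) :
    ∃ C : ℝ, ∀ f : V → ℝ, Continuous f → (∀ x, M < ‖x‖ → f x = 0) → ∀ S : ℝ,
      (∀ x, |f x| ≤ S) → |convValue c b s r p f| ≤ C * S := by
  have := (Coercive.of_inner hw).isLocallyFiniteMeasure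
  obtain ⟨R, hR⟩ := exists_shiftInt_eq_zero hw M
  obtain ⟨P, hP⟩ := (isCompact_closedBall (0 : r) R).exists_bound_of_continuousOn hp.continuousOn
  set m := (coneMeasure b s).real (Metric.closedBall 0 (M + R))
  refine ⟨|c| * (|P| * m * (volume : Measure r).real (Metric.closedBall 0 R)),
    fun f hf hM S hS => ?_⟩
  have hS0 : 0 ≤ S := (abs_nonneg _).trans (hS 0)
  have hwy (y : r) : |⟪w, (y : V)⟫| ≤ 1 := by
    rw [Submodule.inner_left_of_mem_orthogonal y.2 hwr]
    simp
  have h1 (y : r) (hy : y ∈ Metric.closedBall (0 : r) R) :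
      |shiftInt (coneMeasure b s) f y| ≤ S * m := by
    refine abs_integral_le_of_support _ (isCompact_closedBall (0 : V) (M + R)) (fun x hx => ?_)
      fun x => hS _
    refine hM _ ?_
    have hx' : M + R < ‖x‖ := by simpa using hx
    have hy' : ‖(y : V)‖ ≤ R := by simpa using hy
    have h2 := norm_sub_le (x + y) (y : V)
    rw [add_sub_cancel_right] at h2
    linarith
  have h2 : |∫ y : r, p y * shiftInt (coneMeasure b s) f y| ≤
      |P| * (S * m) * (volume : Measure r).real (Metric.closedBall 0 R) := by
    have h0 (y : r) (hy : y ∉ Metric.closedBall (0 : r) R) :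
        p y * shiftInt (coneMeasure b s) f y = 0 := by
      rw [hR f hf hM y (hwy y) (by simpa using hy), mul_zero]
    rw [← setIntegral_eq_integral_of_forall_compl_eq_zero h0]
    have := norm_setIntegral_le_of_norm_le_const (μ := (volume : Measure r))
      (s := Metric.closedBall (0 : r) R) (C := |P| * (S * m))
      (f := fun y : r => p y * shiftInt (coneMeasure b s) f y)
      (isCompact_closedBall _ _).measure_lt_top fun y hy => by
        rw [norm_mul]
        exact mul_le_mul ((hP y hy).trans (le_abs_self P)) (h1 y hy) (norm_nonneg _)
          (abs_nonneg _)
    exact this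
  unfold convValue
  rw [abs_mul]
  calc |c| * _ ≤ |c| * _ := mul_le_mul_of_nonneg_left h2 (abs_nonneg c)
    _ = _ := by ring

theorem exists_distr_convValue (c : ℝ) {p : r → ℝ} (hp : Continuous p)
    (hw : ∀ i ∈ s, 0 < ⟪w, b i⟫) (hwr : w ∈ rᗮ) :
    ∃ R : Distr V, ∀ f : Test V, R f = convValue c b s r p f := by
  let L : Test V →ₗ[ℝ] ℝ :=
    { toFun f := convValue c b s r p f
      map_add' f g := convValue_add c hp hw hwr (.of_test f) (.of_test g)
      map_smul' k f := convValue_const_mul c p k f }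
  refine ⟨distrOfBound L fun M => ?_, fun f => rfl⟩
  obtain ⟨C, hC⟩ := exists_convValue_bound c hp hw hwr M
  exact ⟨C, fun f hM S hS => hC f f.continuous hM S hS⟩

/-- Derivative in the directions of the subspace. -/
theorem convValue_dirDeriv_of_mem (c : ℝ) {p : r → ℝ} (hp : ContDiff ℝ ∞ p)
    (hw : ∀ i ∈ s, 0 < ⟪w, b i⟫) (hwr : w ∈ rᗮ) (v : r) {f : V → ℝ} (hf : IsTest f) :
    convValue c b s r p (dirDeriv (v : V) f) = -convValue c b s r (dirDeriv v p) f := by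
  have := (Coercive.of_inner hw).isLocallyFiniteMeasure
  have hg := hf.shiftInt_restrict hw hwr
  have h1 := integral_mul_dirDeriv (volume : Measure r) hp hg v
  have h2 (y : r) : dirDeriv v (fun y : r => shiftInt (coneMeasure b s) f y) y =
      shiftInt (coneMeasure b s) (dirDeriv (v : V) f) y := by
    rw [← dirDeriv_shiftInt _ hf]
    have h3 := ((hf.contDiff_shiftInt (coneMeasure b s)).differentiable (by simp)
      (y : V)).hasFDerivAt.comp y r.subtypeL.hasFDerivAt
    exact congrArg (· v) h3.fderiv
  simp_rw [h2] at h1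
  unfold convValue
  rw [h1]
  ring

omit [FiniteDimensional ℝ V] [MeasurableSpace V] [BorelSpace V] in
theorem dirDeriv_translate (v y : V) (f : V → ℝ) :
    dirDeriv v (fun x => f (x + y)) = fun x => dirDeriv v f (x + y) := by
  ext x
  simp [dirDeriv, fderiv_comp_add_right]

/-- Derivative in the directions of the cone. -/
theorem convValue_dirDeriv_of_insert [DecidableEq ι] (c : ℝ) (p : r → ℝ) {j : ι} (hj : j ∉ s)
    (hw : ∀ i ∈ insert j s, 0 < ⟪w, b i⟫) {f : V → ℝ} (hf : IsTest f) :
    convValue c b (insert j s) r p (dirDeriv (b j) f) = -convValue c b s r p f := by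
  have h2 (y : V) : shiftInt (coneMeasure b (insert j s)) (dirDeriv (b j) f) y =
      -shiftInt (coneMeasure b s) f y := by
    have := integral_dirDeriv_coneMeasure hj (Coercive.of_inner hw) (hf.translate y)
    rwa [dirDeriv_translate] at this
  unfold convValue
  simp_rw [h2, mul_neg, integral_neg]
  ring

/-- Near `r`, the correlation with the cone measure agrees with a test function. -/
theorem exists_cutoff_shiftInt {f : V → ℝ} (hf : IsTest f) (hw : ∀ i ∈ s, 0 < ⟪w, b i⟫)
    (hwr : w ∈ rᗮ) :
    ∃ φ : V → ℝ, IsTest φ ∧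
      ∀ y ∈ r, ∀ᶠ z in 𝓝 y, φ z = shiftInt (coneMeasure b s) f z := by
  have := (Coercive.of_inner hw).isLocallyFiniteMeasure
  obtain ⟨M, hM0, hM⟩ := hf.exists_radius
  obtain ⟨R, hR⟩ := exists_shiftInt_eq_zero hw M
  -- The bump is 1 on a ball of radius larger than `R`; around points of `r` outside that ball the
  -- correlation itself vanishes, so multiplying by the bump changes nothing near `r`.
  let χ : ContDiffBump (0 : V) := ⟨|R| + 1, |R| + 2, by positivity, by linarith⟩
  refine ⟨fun z => shiftInt (coneMeasure b s) f z * χ z, IsTest.mul_left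
    (hf.contDiff_shiftInt _) ⟨χ.contDiff, χ.hasCompactSupport⟩, fun y hy => ?_⟩
  by_cases hyR : ‖y‖ < |R| + 1
  · have h1 : Metric.ball (0 : V) (|R| + 1) ∈ 𝓝 y :=
      Metric.isOpen_ball.mem_nhds (by simpa using hyR)
    filter_upwards [h1] with z hz
    rw [χ.one_of_mem_closedBall (Metric.ball_subset_closedBall hz), mul_one]
  · have h1 : ∀ᶠ z in 𝓝 y, R < ‖z‖ :=
      continuous_norm.continuousAt.eventually (lt_mem_nhds (by
        have := le_abs_self R
        linarith [not_lt.1 hyR]))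
    have h2 : ∀ᶠ z in 𝓝 y, |⟪w, z⟫| < 1 := by
      have hc : Continuous fun z => |⟪w, z⟫| := by fun_prop
      refine hc.continuousAt.eventually (gt_mem_nhds ?_)
      simp only
      rw [Submodule.inner_left_of_mem_orthogonal hy hwr]
      simp
    filter_upwards [h1, h2] with z hz1 hz2
    rw [hR f hf.continuous hM z hz2.le hz1, zero_mul]

/-- On a small ball around `y` the density keeps the sign of `p y`, so a bump function there has a
nonzero value under `S`. -/
theorem mem_dsupport_of_ne_zero {S : Distr V} {p : r → ℝ} (hp : Continuous p)
    (hS : ∀ f : Test V, S f = ∫ y : r, p y * f y) {y : r} (hy : p y ≠ 0) :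
    (y : V) ∈ Distribution.dsupport S := by
  rw [Distribution.mem_dsupport_iff_forall_exists_ne]
  intro U hyU hU
  obtain ⟨ε, hε, hball⟩ := Metric.isOpen_iff.1 hU y hyU
  have h1 : ∀ᶠ z in 𝓝 y, 0 < p y * p z := by
    have hc : Continuous fun z => p y * p z := by fun_prop
    exact hc.continuousAt.eventually (lt_mem_nhds (mul_self_pos.2 hy))
  obtain ⟨δ, hδ, hpos⟩ := Metric.eventually_nhds_iff.1 h1
  have hmin : 0 < min ε δ := lt_min hε hδ
  let χ : ContDiffBump (y : V) := ⟨min ε δ / 4, min ε δ / 2, by positivity, by linarith⟩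
  have hχ : IsTest χ := ⟨χ.contDiff, χ.hasCompactSupport⟩
  refine ⟨hχ.toTest, ?_, ?_⟩
  · change tsupport χ ⊆ U
    rw [χ.tsupport_eq]
    refine (Metric.closedBall_subset_ball ?_).trans hball
    change min ε δ / 2 < ε
    have := min_le_left ε δ
    linarith
  · rw [hS]
    intro h0
    have h2 : 0 < ∫ z : r, p y * (p z * χ z) := by
      refine Continuous.integral_pos_of_hasCompactSupport_nonneg_nonzero (x := y) ?_ ?_ ?_ ?_
      · exact continuous_const.mul (hp.mul (hχ.restrict r).continuous)
      · exact (hχ.restrict r).hasCompactSupport.mul_left.mul_left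
      · intro z
        change 0 ≤ p y * (p z * χ z)
        by_cases hz : dist z y < δ
        · have := hpos hz
          rw [← mul_assoc]
          exact mul_nonneg this.le χ.nonneg
        · rw [χ.zero_of_le_dist]
          · simp
          · change min ε δ / 2 ≤ dist z y
            have := min_le_right ε δ
            linarith [not_lt.1 hz]
      · rw [χ.one_of_mem_closedBall (Metric.mem_closedBall_self χ.rIn_pos.le), mul_one]
        exact mul_ne_zero hy hy
    rw [integral_const_mul] at h2
    simp only [IsTest.toTest_apply] at h0
    rw [h0] at h2
    simp at h2

theorem existsUnique_isConvolution {c : ℝ} {T S : Distr V} {p : r → ℝ} (hp : Continuous p)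
    (hw : ∀ i ∈ s, 0 < ⟪w, b i⟫) (hwr : w ∈ rᗮ)
    (hT : ∀ f : Test V, T f = c * ∫ x, f x ∂coneMeasure b s)
    (hS : ∀ f : Test V, S f = ∫ y : r, p y * f y) :
    (∃! R, IsConvolution T S R) ∧
      ∀ R, IsConvolution T S R → ∀ f : Test V, R f = convValue c b s r p f := by
  have hTt (f : Test V) (y : V) :
      T (translate y f) = c * shiftInt (coneMeasure b s) f y := hT _
  have hval : ∀ R, IsConvolution T S R → ∀ f : Test V, R f = convValue c b s r p f := by
    intro R hR f
    obtain ⟨φ, hφ, hRf⟩ := hR f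
    rw [hRf, hS, convValue, ← integral_const_mul]
    refine integral_congr_ae (.of_forall fun y => ?_)
    -- Where `p` vanishes the integrands agree trivially; elsewhere `y` lies in the support of `S`,
    -- where `φ` is prescribed.
    by_cases hy : p y = 0
    · simp [hy]
    · have := subset_of_mem_nhdsSet hφ (mem_dsupport_of_ne_zero hp hS hy)
      have h2 : φ (y : V) = T (translate (y : V) f) := this
      simp only
      rw [h2, hTt]
      ring
  refine ⟨?_, hval⟩
  obtain ⟨R, hR⟩ := exists_distr_convValue c hp hw hwr
  refine ⟨R, fun f => ?_, fun R' hR' => ?_⟩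
  · obtain ⟨φ, hφ, hφf⟩ := exists_cutoff_shiftInt (.of_test f) hw hwr
    have hcφ : IsTest fun z => c * φ z := hφ.mul_left contDiff_const
    refine ⟨hcφ.toTest, ?_, ?_⟩
    · refine eventually_nhdsSet_iff_forall.2 fun y hy => ?_
      -- The support of `S` lies in the closed set `r`, since `S` kills test functions supported off
      -- `r`.
      have hyr : y ∈ r := by
        by_contra hyr
        rw [Distribution.mem_dsupport_iff_forall_exists_ne] at hy
        obtain ⟨u, hu, hu0⟩ := hy (r : Set V)ᶜ hyr r.closed_of_finiteDimensional.isOpen_compl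
        apply hu0
        rw [hS]
        refine integral_eq_zero_of_ae (.of_forall fun z => ?_)
        simp [image_eq_zero_of_notMem_tsupport fun h => hu h z.2]
      filter_upwards [hφf y hyr] with z hz
      rw [hTt, IsTest.toTest_apply, hz]
    · rw [hR, hS, convValue, ← integral_const_mul]
      refine integral_congr_ae (.of_forall fun y => ?_)
      simp only [IsTest.toTest_apply]
      rw [(hφf y y.2).self_of_nhds]
      ring
  · ext f
    rw [hR, hval R' hR' f]

end Conv

/-! ### Functionals invariant under translations and locally zero -/

section Invariant

variable {V : Type*} [NormedAddCommGroup V] [InnerProductSpace ℝ V] [FiniteDimensional ℝ V]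

open scoped Manifold in
/-- A test function is a sum of test functions with small supports. -/
theorem IsTest.exists_sum_of_cover {f : V → ℝ} (hf : IsTest f) (U : V → Set V)
    (hU : ∀ x, IsOpen (U x)) (hx : ∀ x, x ∈ U x) :
    ∃ (t : Finset V) (g : V → V → ℝ), (∀ x ∈ t, IsTest (g x) ∧ tsupport (g x) ⊆ U x) ∧
      f = fun z => ∑ x ∈ t, g x z := by
  obtain ⟨t, ht⟩ := hf.hasCompactSupport.isCompact.elim_finite_subcover U hU
    fun x _ => mem_iUnion.2 ⟨x, hx x⟩
  have hcov : tsupport f ⊆ ⋃ x : t, U x := by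
    refine ht.trans fun z hz => ?_
    simp only [mem_iUnion] at hz ⊢
    obtain ⟨x, hxt, hz⟩ := hz
    exact ⟨⟨x, hxt⟩, hz⟩
  obtain ⟨ρ, hρ⟩ := SmoothPartitionOfUnity.exists_isSubordinate 𝓘(ℝ, V)
    (isClosed_tsupport f) (fun x : t => U x) (fun x => hU x) hcov
  classical
  refine ⟨t, fun x z => if h : x ∈ t then ρ ⟨x, h⟩ z * f z else 0, fun x hxt => ?_, ?_⟩
  · simp only [hxt, dif_pos]
    exact ⟨hf.mul_left (ρ ⟨x, hxt⟩).contMDiff.contDiff,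
      tsupport_mul_subset_left.trans (hρ ⟨x, hxt⟩)⟩
  · ext z
    rw [← Finset.sum_coe_sort]
    simp only [Finset.coe_mem, dif_pos]
    rw [← Finset.sum_mul]
    by_cases hz : z ∈ tsupport f
    · have := ρ.sum_eq_one hz
      rw [finsum_eq_sum_of_fintype] at this
      rw [this, one_mul]
    · rw [image_eq_zero_of_notMem_tsupport hz, mul_zero]

/-- Vanishing on derivatives along the span gives translation invariance. A partition of unity cuts
`f` into small pieces, each of which can be translated along the span until its support meets the
span only inside `N`. -/
theorem eq_zero_of_invariant {L : (V → ℝ) → ℝ}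
    (hadd : ∀ f g, IsTest f → IsTest g → L (fun x => f x + g x) = L f + L g)
    (hsmul : ∀ (c : ℝ) f, IsTest f → L (fun x => c * f x) = c * L f)
    {S : Set V} (hder : ∀ v ∈ S, ∀ f, IsTest f → L (dirDeriv v f) = 0)
    {N : Set V} (hN : IsOpen N) {x₀ : V} (hx₀ : x₀ ∈ Submodule.span ℝ S) (hx₀N : x₀ ∈ N)
    (hloc : ∀ f, IsTest f → (∀ x ∈ Submodule.span ℝ S, x ∈ tsupport f → x ∈ N) → L f = 0)
    {f : V → ℝ} (hf : IsTest f) : L f = 0 := by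
  have hzero : L (fun _ => 0) = 0 := by simpa using hsmul 0 _ IsTest.zero
  have hder' : ∀ v ∈ Submodule.span ℝ S, ∀ f, IsTest f → L (dirDeriv v f) = 0 := by
    intro v hv f hf
    induction hv using Submodule.span_induction with
    | mem v hv => exact hder v hv f hf
    | zero =>
      have : dirDeriv (0 : V) f = fun _ => 0 := by ext; simp [dirDeriv]
      rw [this, hzero]
    | add u v _ _ hu hv =>
      have : dirDeriv (u + v) f = fun x => dirDeriv u f x + dirDeriv v f x := by
        ext; simp [dirDeriv]
      rw [this, hadd _ _ (hf.dirDeriv u) (hf.dirDeriv v), hu, hv, add_zero]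
    | smul c v _ hv =>
      have : dirDeriv (c • v) f = fun x => c * dirDeriv v f x := by ext; simp [dirDeriv]
      rw [this, hsmul _ _ (hf.dirDeriv v), hv, mul_zero]
  have htrans : ∀ v ∈ Submodule.span ℝ S, ∀ f, IsTest f → L (fun x => f (x + v)) = L f := by
    intro v hv f hf
    borelize V
    -- The difference between the translate of `f` and `f` is a derivative along `v`, so `L` does
    -- not see it.
    obtain ⟨G, hG, hGf⟩ := hf.exists_dirDeriv_eq v
    have h1 := hadd _ _ (hG.dirDeriv v) hf
    rw [hder' v hv G hG, zero_add] at h1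
    rw [← h1]
    congr 1
    ext x
    rw [hGf]
    ring
  have hsum : ∀ (t : Finset V) (g : V → V → ℝ), (∀ x ∈ t, IsTest (g x)) →
      (∀ x ∈ t, L (g x) = 0) → L (fun z => ∑ x ∈ t, g x z) = 0 := by
    classical
    intro t g
    induction t using Finset.induction_on with
    | empty => intro _ _; simpa using hzero
    | insert x t hx ih =>
      intro h1 h2
      simp only [Finset.sum_insert hx]
      rw [hadd _ _ (h1 x (by simp)) (IsTest.sum t fun k hk => h1 k (by simp [hk])),
        h2 x (by simp), ih (fun k hk => h1 k (by simp [hk])) (fun k hk => h2 k (by simp [hk])),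
        add_zero]
  set W := Submodule.span ℝ S
  have hcont : Continuous fun z : V => W.starProjection z := W.starProjection.continuous
  -- The piece around `x` is to be translated by `x₀ - W.starProjection x`, which takes the
  -- projection of `x` to `x₀`; its neighbourhood consists of the points whose projection then lands
  -- in `N`.
  obtain ⟨t, g, hg, rfl⟩ := hf.exists_sum_of_cover
    (fun x => {z | W.starProjection z + (x₀ - W.starProjection x) ∈ N})
    (fun x => hN.preimage (hcont.add continuous_const)) (fun x => by simpa using hx₀N)
  refine hsum t g (fun x hx => (hg x hx).1) fun x hx => ?_
  obtain ⟨hgx, hgU⟩ := hg x hx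
  have hv : x₀ - W.starProjection x ∈ W := W.sub_mem hx₀ (W.starProjection_apply_mem x)
  rw [← htrans (-(x₀ - W.starProjection x)) (W.neg_mem hv) _ hgx]
  refine hloc _ (hgx.translate _) fun z hz hzt => ?_
  have h1 : z + -(x₀ - W.starProjection x) ∈ tsupport (g x) :=
    tsupport_comp_subset_preimage (g x)
      (f := fun z => z + -(x₀ - W.starProjection x)) (by fun_prop) hzt
  have h2 : W.starProjection (z + -(x₀ - W.starProjection x)) + (x₀ - W.starProjection x) ∈ N :=
    hgU h1
  rwa [W.starProjection_eq_self_iff.2 (W.add_mem hz (W.neg_mem hv)), neg_add_cancel_right] at h2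

end Invariant

/-! ### The terms of the decomposition -/

section Terms

open scoped Classical

variable {V ι : Type*} [NormedAddCommGroup V] [InnerProductSpace ℝ V] [FiniteDimensional ℝ V]
  [MeasurableSpace V] [BorelSpace V] [Fintype ι]

omit [FiniteDimensional ℝ V] [MeasurableSpace V] [BorelSpace V] in
theorem Coercive.inter {a : ι → V} {s : Finset ι} (h : Coercive a s) (r : Submodule ℝ V) :
    Coercive (inter a r) (s.subtype (a · ∈ r)) := by
  have h1 : Coercive (fun k : {i // a i ∈ r} => a k) (s.subtype (a · ∈ r)) :=
    Coercive.comp (e := Function.Embedding.subtype _) (h.mono (by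
      intro i
      simp +contextual))
  obtain ⟨c, hc, H⟩ := h1
  refine ⟨c, hc, fun t ht ht' => (H t ht ht').trans (le_of_eq ?_)⟩
  change _ = ‖((comb (Spline.inter a r) t : r) : V)‖
  congr 1
  simp [comb, Spline.inter]

omit [FiniteDimensional ℝ V] in
theorem integral_coneMeasure_inter (a : ι → V) (r : Submodule ℝ V) (s : Finset ι) {f : V → ℝ}
    (hf : Continuous f) :
    ∫ y, f y ∂coneMeasure (inter a r) (s.subtype (a · ∈ r)) =
      ∫ x, f x ∂coneMeasure a (s.filter (a · ∈ r)) := by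
  have h := coneMeasure_map a (Function.Embedding.subtype (a · ∈ r)) (s.subtype (a · ∈ r))
  rw [Finset.subtype_map] at h
  rw [h, integral_coneMeasure _ _ hf,
    integral_coneMeasure _ _ (f := fun y : r => f y) (hf.comp continuous_subtype_val)]
  congr 1
  ext t
  congr 1
  simp [comb, Spline.inter]

/-- The vectors `a i`, with the sign changed for those that are positive on `u`. -/
def flip (a : ι → V) (u : V) (i : ι) : V := if 0 < ⟪u, a i⟫ then -a i else a i

/-- The sign `(-1)^k`, where `k` is the number of vectors of `s` outside of `r` that are positive
on `u`. -/
def flipSign (a : ι → V) (u : V) (r : Submodule ℝ V) (s : Finset ι) : ℝ :=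
  (-1) ^ (s.filter fun i => a i ∉ r ∧ 0 < ⟪u, a i⟫).card

/-- The value at `f` of the term of the decomposition that belongs to `r`, for the sublist `s`. -/
def termValue (a : ι → V) (β : V) (s : Finset ι) (r : Submodule ℝ V) (f : V → ℝ) : ℝ :=
  convValue (flipSign a (rᗮ.starProjection β) r s) (flip a (rᗮ.starProjection β))
    (s.filter (a · ∉ r)) r
    (locPoly volume (inter a r) (betaTope a r β) (s.subtype (a · ∈ r))) f

omit [FiniteDimensional ℝ V] [MeasurableSpace V] [BorelSpace V] [Fintype ι] in
-- This makes `-u` the vector `w` required by the convolution lemmas.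
theorem inner_flip_neg {a : ι → V} {u : V} {i : ι} (h : ⟪u, a i⟫ ≠ 0) :
    0 < ⟪-u, flip a u i⟫ := by
  unfold flip
  split_ifs with h1
  · simpa using h1
  · have := lt_of_le_of_ne (not_lt.1 h1) h
    simpa using this

/-- The hypotheses of the decomposition theorem at the subspace `r`. -/
structure GoodSubspace (a : ι → V) (β : V) (r : Submodule ℝ V) : Prop where
  isChamber : IsChamber (inter a r) (betaTope a r β)
  mem : r.orthogonalProjectionOnto β ∈ betaTope a r β
  inner_ne_zero : ∀ i, a i ∉ r → ⟪rᗮ.starProjection β, a i⟫ ≠ 0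

omit [MeasurableSpace V] [BorelSpace V] in
theorem GoodSubspace.inner_pos {a : ι → V} {β : V} {r : Submodule ℝ V} (h : GoodSubspace a β r)
    (s : Finset ι) : ∀ i ∈ s.filter (a · ∉ r),
      0 < ⟪-rᗮ.starProjection β, flip a (rᗮ.starProjection β) i⟫ :=
  fun i hi => inner_flip_neg (h.inner_ne_zero i (Finset.mem_filter.1 hi).2)

omit [MeasurableSpace V] [BorelSpace V] in
theorem neg_starProjection_mem (r : Submodule ℝ V) (β : V) : -rᗮ.starProjection β ∈ rᗮ :=
  rᗮ.neg_mem (rᗮ.starProjection_apply_mem β)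

variable {a : ι → V} {β : V} {r : Submodule ℝ V}

theorem GoodSubspace.isLocPoly (h : GoodSubspace a β r) (ha : Coercive a Finset.univ)
    (s : Finset ι) : IsLocPoly volume (inter a r) (betaTope a r β) (s.subtype (a · ∈ r))
      (locPoly volume (inter a r) (betaTope a r β) (s.subtype (a · ∈ r))) :=
  h.isChamber.isLocPoly ((ha.mono (Finset.subset_univ s)).inter r)

theorem GoodSubspace.termValue_add (h : GoodSubspace a β r) (ha : Coercive a Finset.univ)
    (s : Finset ι) {f g : V → ℝ} (hf : IsTest f) (hg : IsTest g) :
    termValue a β s r (fun x => f x + g x) = termValue a β s r f + termValue a β s r g :=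
  convValue_add _ (h.isLocPoly ha s).1.continuous (h.inner_pos s)
    (neg_starProjection_mem r β) hf hg

/-- `∂_{a j}` of a term is the corresponding term for the list without `a j`. -/
theorem GoodSubspace.termValue_dirDeriv (h : GoodSubspace a β r) (ha : Coercive a Finset.univ)
    {s : Finset ι} {j : ι} (hj : j ∈ s) {f : V → ℝ} (hf : IsTest f) :
    termValue a β s r (dirDeriv (a j) f) = -termValue a β (s.erase j) r f := by
  unfold termValue
  -- A vector of `r` is removed from the polynomial factor, and any other vector from the cone
  -- factor.
  by_cases hjr : a j ∈ r
  · have h1 := convValue_dirDeriv_of_mem (flipSign a (rᗮ.starProjection β) r s)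
      (h.isLocPoly ha s).1.smooth (h.inner_pos s) (neg_starProjection_mem r β) ⟨a j, hjr⟩ hf
    have hs : (s.erase j).subtype (a · ∈ r) = (s.subtype (a · ∈ r)).erase ⟨j, hjr⟩ := by
      ext i
      simp [Subtype.ext_iff]
    have h2 := h.isChamber.dirDeriv_locPoly (μ := volume)
      ((ha.mono (Finset.subset_univ s)).inter r) (j := ⟨j, hjr⟩) (by simpa using hj)
    have hfil : (s.erase j).filter (a · ∉ r) = s.filter (a · ∉ r) := by
      ext i
      simp only [Finset.mem_filter, Finset.mem_erase]
      exact ⟨fun h => ⟨h.1.2, h.2⟩, fun h => ⟨⟨fun he => h.2 (he ▸ hjr), h.1⟩, h.2⟩⟩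
    have hsign (u : V) : flipSign a u r (s.erase j) = flipSign a u r s := by
      unfold flipSign
      congr 2
      ext i
      simp only [Finset.mem_filter, Finset.mem_erase]
      exact ⟨fun h => ⟨h.1.2, h.2⟩, fun h => ⟨⟨fun he => h.2.1 (he ▸ hjr), h.1⟩, h.2⟩⟩
    rw [hs, ← h2, hfil, hsign]
    exact h1
  · have hs : (s.erase j).subtype (a · ∈ r) = s.subtype (a · ∈ r) := by
      ext i
      simp only [Finset.mem_subtype, Finset.mem_erase, and_iff_right_iff_imp]
      rintro - hij
      exact hjr (hij ▸ i.2)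
    set u := rᗮ.starProjection β with hu
    have hjn : j ∉ (s.erase j).filter (a · ∉ r) := by simp
    have hfil : s.filter (a · ∉ r) = insert j ((s.erase j).filter (a · ∉ r)) := by
      ext i
      simp only [Finset.mem_filter, Finset.mem_erase, Finset.mem_insert]
      by_cases hij : i = j
      · subst hij; simp [hj, hjr]
      · simp [hij]
    have hpos := h.inner_pos s
    rw [← hu, hfil] at hpos
    have h1 := convValue_dirDeriv_of_insert (r := r) (flipSign a u r s)
      (locPoly volume (inter a r) (betaTope a r β) (s.subtype (a · ∈ r))) hjn hpos hf
    rw [hs, hfil]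
    -- For a flipped vector the sign from ∂_{-a j} = -∂_{a j} cancels the one lost as the number of
    -- flipped vectors drops by one.
    by_cases hju : 0 < ⟪u, a j⟫
    · have hflip : flip a u j = -a j := if_pos hju
      have hsign : flipSign a u r (s.erase j) = -flipSign a u r s := by
        have h3 : s.filter (fun i => a i ∉ r ∧ 0 < ⟪u, a i⟫) =
            insert j ((s.erase j).filter fun i => a i ∉ r ∧ 0 < ⟪u, a i⟫) := by
          ext i
          simp only [Finset.mem_filter, Finset.mem_erase, Finset.mem_insert]
          by_cases hij : i = j
          · subst hij; simp [hj, hjr, hju]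
          · simp [hij]
        rw [flipSign, flipSign, h3, Finset.card_insert_of_notMem (by simp), pow_succ]
        ring
      have hd : dirDeriv (flip a u j) f = fun x => (-1) * dirDeriv (a j) f x := by
        ext x
        simp [hflip, dirDeriv]
      rw [hd, convValue_const_mul] at h1
      rw [hsign]
      unfold convValue at h1 ⊢
      linarith
    · have hflip : flip a u j = a j := if_neg hju
      have hsign : flipSign a u r (s.erase j) = flipSign a u r s := by
        unfold flipSign
        congr 2
        ext i
        simp only [Finset.mem_filter, Finset.mem_erase]
        exact ⟨fun h => ⟨h.1.2, h.2⟩, fun h => ⟨⟨fun he => hju (he ▸ h.2.2), h.1⟩, h.2⟩⟩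
      rw [hflip] at h1
      rw [hsign, h1]

/-- Terms that vanish since the sublist of the vectors in `r` does not span `r`. -/
theorem GoodSubspace.termValue_of_not_le (h : GoodSubspace a β r) (ha : Coercive a Finset.univ)
    {s : Finset ι} (hr : ¬r ≤ Submodule.span ℝ (a '' (s : Set ι))) (f : V → ℝ) :
    termValue a β s r f = 0 := by
  have h1 : Submodule.span ℝ (inter a r '' ((s.subtype (a · ∈ r) : Finset _) : Set _)) ≠ ⊤ := by
    intro htop
    apply hr
    have h2 := congrArg (Submodule.map r.subtype) htop
    rw [Submodule.map_span, Submodule.map_top, Submodule.range_subtype] at h2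
    rw [← h2]
    refine Submodule.span_mono ?_
    rintro _ ⟨_, ⟨i, hi, rfl⟩, rfl⟩
    exact ⟨i, by simpa using hi, rfl⟩
  unfold termValue convValue
  rw [h.isChamber.locPoly_eq_zero ((ha.mono (Finset.subset_univ s)).inter r) h1]
  simp

omit [MeasurableSpace V] [BorelSpace V] [FiniteDimensional ℝ V] [Fintype ι] in
theorem flip_mem {a : ι → V} {u : V} {W : Submodule ℝ V} {i : ι} (h : a i ∈ W) :
    flip a u i ∈ W := by
  unfold flip
  split_ifs
  · exact W.neg_mem h
  · exact h

/-- Terms of proper subspaces are supported on a half-space. -/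
theorem GoodSubspace.termValue_of_lt (h : GoodSubspace a β r)
    {s : Finset ι} (hr : r ≤ Submodule.span ℝ (a '' (s : Set ι))) {f : V → ℝ}
    (hf : IsTest f) (hsupp : ∀ x ∈ Submodule.span ℝ (a '' (s : Set ι)), x ∈ tsupport f →
      0 < ⟪rᗮ.starProjection β, x⟫) :
    termValue a β s r f = 0 := by
  unfold termValue convValue
  rw [integral_eq_zero_of_ae, mul_zero]
  refine .of_forall fun y => ?_
  set u := rᗮ.starProjection β with hu
  have h1 : shiftInt (coneMeasure (flip a u) (s.filter (a · ∉ r))) f y = 0 := by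
    refine integral_coneMeasure_eq_zero _ _ (hf.continuous.comp (continuous_add_const _))
      fun t ht ht' => ?_
    by_contra hne
    have hmem : comb (flip a u) t + y ∈ Submodule.span ℝ (a '' (s : Set ι)) := by
      refine Submodule.add_mem _ (Submodule.sum_mem _ fun i _ => ?_) (hr y.2)
      by_cases hi : i ∈ s.filter (a · ∉ r)
      · exact Submodule.smul_mem _ _
          (flip_mem (Submodule.subset_span ⟨i, (Finset.mem_filter.1 hi).1, rfl⟩))
      · rw [ht' i hi, zero_smul]
        exact Submodule.zero_mem _
    have hpos := hsupp _ hmem (subset_tsupport _ hne)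
    rw [inner_add_right, Submodule.inner_left_of_mem_orthogonal y.2
      (rᗮ.starProjection_apply_mem β), add_zero] at hpos
    -- The flipped cone lies where `u` is nonpositive and the `r`-component is orthogonal to `u`,
    -- contradicting the support condition.
    obtain ⟨c, hc, H⟩ := coercive_of_inner (h.inner_pos s)
    have h2 := H t ht ht'
    rw [inner_neg_left] at h2
    have h3 : 0 ≤ c * ∑ i, t i := mul_nonneg hc.le (Finset.sum_nonneg fun i _ => ht i)
    linarith
  simp [h1]

/-- The term of the largest subspace is the local polynomial of the spline. -/
theorem GoodSubspace.termValue_of_eq {s : Finset ι}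
    (h : GoodSubspace a β (Submodule.span ℝ (a '' (s : Set ι)))) (ha : Coercive a Finset.univ)
    {f : V → ℝ} (hf : IsTest f)
    (hsupp : ∀ x : Submodule.span ℝ (a '' (s : Set ι)), (x : V) ∈ tsupport f →
      x ∈ betaTope a (Submodule.span ℝ (a '' (s : Set ι))) β) :
    termValue a β s (Submodule.span ℝ (a '' (s : Set ι))) f = ∫ x, f x ∂coneMeasure a s := by
  set W := Submodule.span ℝ (a '' (s : Set ι)) with hW
  have hmem : ∀ i ∈ s, a i ∈ W := fun i hi => Submodule.subset_span ⟨i, hi, rfl⟩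
  have h1 : s.filter (a · ∉ W) = ∅ := Finset.filter_eq_empty_iff.2 fun i hi => by
    simpa using hmem i hi
  have h2 : s.filter (a · ∈ W) = s := Finset.filter_true_of_mem hmem
  have h3 : flipSign a (Wᗮ.starProjection β) W s = 1 := by
    have : s.filter (fun i => a i ∉ W ∧ 0 < ⟪Wᗮ.starProjection β, a i⟫) = ∅ :=
      Finset.filter_eq_empty_iff.2 fun i hi h => h.1 (hmem i hi)
    rw [flipSign, this]
    simp
  unfold termValue convValue
  rw [h1, h3, coneMeasure_empty]
  have h4 (y : V) : shiftInt (Measure.dirac 0) f y = f y := by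
    unfold shiftInt
    rw [integral_dirac]
    simp
  simp_rw [h4, one_mul]
  have hsub : tsupport (fun y : W => f y) ⊆ betaTope a W β := fun y hy =>
    hsupp y (tsupport_comp_subset_preimage f continuous_subtype_val hy)
  rw [← (h.isLocPoly ha s).2 _ (hf.restrict W) hsub, integral_coneMeasure_inter a W s hf.continuous,
    h2]

omit [MeasurableSpace V] [BorelSpace V] [Fintype ι] in
/-- The projection of `β` to `W` is positive on the normal vectors of smaller subspaces. -/
theorem inner_starProjection_pos {W : Submodule ℝ V} (hrW : r ≤ W) {i : ι} (hi : a i ∈ W)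
    (hne : ⟪rᗮ.starProjection β, a i⟫ ≠ 0) :
    0 < ⟪rᗮ.starProjection β, W.starProjection β⟫ := by
  rw [Submodule.starProjection_orthogonal_val] at hne ⊢
  have hW (x : V) (hx : x ∈ W) : ⟪β - W.starProjection β, x⟫ = 0 :=
    Submodule.inner_left_of_mem_orthogonal hx (Submodule.sub_starProjection_mem_orthogonal β)
  have hr (x : V) (hx : x ∈ r) : ⟪β - r.starProjection β, x⟫ = 0 :=
    Submodule.inner_left_of_mem_orthogonal hx (Submodule.sub_starProjection_mem_orthogonal β)
  set p := W.starProjection β with hp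
  set q := r.starProjection β with hq
  have hpW : p ∈ W := W.starProjection_apply_mem β
  have hqr : q ∈ r := r.starProjection_apply_mem β
  have e1 := hW p hpW
  have e2 := hW q (hrW hqr)
  have e3 := hr q hqr
  have e4 := hW (a i) hi
  -- If the projections to `W` and `r` agreed, `β - q = β - p` would be orthogonal to `a i ∈ W`,
  -- against regularity. The inner product in question is ‖p - q‖².
  have hd : p - q ≠ 0 := by
    intro h0
    apply hne
    rw [← sub_eq_zero.1 h0]
    exact e4
  have h1 : ⟪β - q, p⟫ = ⟪p - q, p - q⟫ := by
    simp only [inner_sub_left, inner_sub_right] at e1 e2 e3 ⊢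
    rw [real_inner_comm p q] at *
    linarith
  rw [h1]
  exact real_inner_self_pos.2 hd

/-- The decomposition for all sublists of `a`. -/
theorem integral_coneMeasure_eq_sum_termValue (ha : Coercive a Finset.univ)
    (hgood : ∀ r ∈ rationalSubspaces a, GoodSubspace a β r) (s : Finset ι) {f : V → ℝ}
    (hf : IsTest f) :
    ∫ x, f x ∂coneMeasure a s = ∑ r ∈ rationalSubspaces a, termValue a β s r f := by
  induction s using Finset.strongInduction generalizing f with
  | H s ih =>
  have hs := ha.mono (Finset.subset_univ s)
  have := hs.isLocallyFiniteMeasure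
  set W := Submodule.span ℝ (a '' (s : Set ι)) with hW
  have hWr : W ∈ rationalSubspaces a := Finset.mem_image.2 ⟨s, Finset.mem_univ _, rfl⟩
  obtain ⟨NW, hNW, hNWeq⟩ := isOpen_induced_iff.1 (hgood W hWr).isChamber.isOpen
  -- The first set cuts out the tope of the projection of `β` in `W`; the half-spaces remove the
  -- terms of all proper rational subspaces of `W`.
  let N : Set V := NW ∩ ⋂ r ∈ (rationalSubspaces a).filter (· < W),
    {x | 0 < ⟪rᗮ.starProjection β, x⟫}
  have hN : IsOpen N := hNW.inter (isOpen_biInter_finset fun r _ =>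
    isOpen_lt continuous_const (by fun_prop))
  have key := eq_zero_of_invariant (S := a '' (s : Set ι)) (N := N) (x₀ := W.starProjection β)
    (L := fun f => ∫ x, f x ∂coneMeasure a s - ∑ r ∈ rationalSubspaces a, termValue a β s r f)
    ?_ ?_ ?_ hN (W.starProjection_apply_mem β) ?_ ?_ hf
  · exact sub_eq_zero.1 key
  · intro f g hf hg
    simp only
    rw [integral_add (hf.integrable _) (hg.integrable _),
      Finset.sum_congr rfl fun r hr => (hgood r hr).termValue_add ha s hf hg,
      Finset.sum_add_distrib]
    ring
  · intro c f _
    simp only [termValue, convValue_const_mul, integral_const_mul, ← Finset.mul_sum]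
    ring
  -- Differentiating both sides gives the identity for `s.erase j`, which is the induction
  -- hypothesis.
  · rintro _ ⟨j, hj, rfl⟩ f hf
    have hi := Finset.insert_erase hj
    have h1 := integral_dirDeriv_coneMeasure (b := a) (s := s.erase j) (j := j) (by simp)
      (by rwa [hi]) hf
    rw [hi] at h1
    rw [h1, Finset.sum_congr rfl fun r hr => (hgood r hr).termValue_dirDeriv ha hj hf,
      ih _ (Finset.erase_ssubset hj) hf, Finset.sum_neg_distrib]
    ring
  · refine ⟨?_, mem_iInter₂.2 fun r hr => ?_⟩
    · have h1 := (hgood W hWr).mem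
      rw [← hNWeq] at h1
      simpa using h1
    · obtain ⟨hrS, hrW⟩ := Finset.mem_filter.1 hr
      obtain ⟨i, hi, hir⟩ : ∃ i ∈ s, a i ∉ r := by
        by_contra! hall
        refine hrW.not_ge (Submodule.span_le.2 ?_)
        rintro _ ⟨i, hi, rfl⟩
        exact hall i hi
      exact inner_starProjection_pos hrW.le (Submodule.subset_span ⟨i, hi, rfl⟩)
        ((hgood r hrS).inner_ne_zero i hir)
  -- Near the chosen point only the term of `W` survives, and it equals the spline.
  · intro f hf hsupp
    rw [sub_eq_zero, Finset.sum_eq_single_of_mem W hWr]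
    · refine ((hgood W hWr).termValue_of_eq ha hf fun x hx => ?_).symm
      rw [← hNWeq]
      exact (hsupp x x.2 hx).1
    · intro r hr hrW
      by_cases hle : r ≤ W
      · refine (hgood r hr).termValue_of_lt hle hf fun x hx hxf => ?_
        exact mem_iInter₂.1 (hsupp x hx hxf).2 r
          (Finset.mem_filter.2 ⟨hr, lt_of_le_of_ne hle hrW⟩)
      · exact (hgood r hr).termValue_of_not_le ha hle f

end Terms

/-! ### Splines and polynomial densities as distributions -/

section Distributions

variable {E ι : Type*} [NormedAddCommGroup E] [NormedSpace ℝ E] [Fintype ι]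

/-- The norm of the combination attains its minimum on the compact standard simplex; pointedness
makes this minimum positive, and homogeneity extends the bound to the orthant. -/
theorem coercive_of_generatesPointedCone {b : ι → E} (hb : ∀ i, b i ≠ 0)
    (hp : GeneratesPointedCone b) : Coercive b Finset.univ := by
  classical
  have hmem : ∀ (s : Finset ι) (t : ι → ℝ), (∀ i, 0 ≤ t i) →
      ∑ i ∈ s, t i • b i ∈ PointedCone.hull ℝ (Set.range b) := fun s t ht =>
    sum_mem fun i _ => Submodule.smul_mem _ (⟨t i, ht i⟩ : NNReal)
      (Submodule.subset_span (Set.mem_range_self i))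
  rcases isEmpty_or_nonempty ι with he | ⟨⟨i0⟩⟩
  · exact ⟨1, one_pos, by simp⟩
  obtain ⟨t0, ht0, hmin⟩ := (isCompact_stdSimplex ℝ ι).exists_isMinOn
    ⟨_, single_mem_stdSimplex ℝ i0⟩ (continuous_comb b).norm.continuousOn
  refine ⟨‖comb b t0‖, norm_pos_iff.2 fun h0 => ?_, fun t ht _ => ?_⟩
  · obtain ⟨j, hj⟩ : ∃ j, t0 j ≠ 0 := by
      by_contra! h
      have := ht0.2
      simp [h] at this
    -- A vanishing combination expresses `-(t0 j • b j)` through the other terms, so the cone would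
    -- contain a nonzero vector and its negative.
    have hsum := Finset.add_sum_erase Finset.univ (fun i => t0 i • b i) (Finset.mem_univ j)
    rw [show ∑ i, t0 i • b i = 0 from h0] at hsum
    refine hp (t0 j • b j) ?_ (smul_ne_zero hj (hb j)) ?_
    · simpa using hmem {j} t0 ht0.1
    · rw [neg_eq_of_add_eq_zero_right hsum]
      exact hmem _ t0 ht0.1
  · rcases (Finset.sum_nonneg fun i (_ : i ∈ Finset.univ) => ht i).eq_or_lt with h | h
    · rw [← h, mul_zero]
      exact norm_nonneg _
    · have hs : (fun i => (∑ j, t j)⁻¹ * t i) ∈ stdSimplex ℝ ι :=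
        ⟨fun i => mul_nonneg (inv_nonneg.2 h.le) (ht i), by
          rw [← Finset.mul_sum, inv_mul_cancel₀ h.ne']⟩
      have h2 : ‖comb b t0‖ ≤ ‖comb b fun i => (∑ j, t j)⁻¹ * t i‖ := hmin hs
      have h3 : comb b (fun i => (∑ j, t j)⁻¹ * t i) = (∑ j, t j)⁻¹ • comb b t := by
        simp [comb, mul_smul, Finset.smul_sum]
      rw [h3, norm_smul, norm_inv, Real.norm_of_nonneg h.le] at h2
      rwa [le_inv_mul_iff₀ h, mul_comm] at h2

theorem coe_lineDeriv_test (v : E) (f : Test E) : ((∂_{v} f : Test E) : E → ℝ) = dirDeriv v f := by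
  ext x
  rw [TestFunction.lineDerivOp_eq_lineDerivCLM (𝕜 := ℝ),
    TestFunction.lineDerivCLM_apply_of_le (by simp)]
  exact ((IsTest.of_test f).differentiable x).lineDeriv_eq_fderiv

variable [MeasurableSpace E] [BorelSpace E]

theorem ofDensity_apply {μ : Measure E} [IsLocallyFiniteMeasure μ] {p : E → ℝ}
    (hp : Continuous p) [SecondCountableTopology E] (f : Test E) :
    ofDensity μ p f = ∫ x, p x * f x ∂μ := by
  have hloc : LocallyIntegrableOn p ((⊤ : Opens E) : Set E) μ :=
    hp.locallyIntegrable.locallyIntegrableOn _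
  change TestFunction.integralAgainstBilinCLM (ContinuousLinearMap.mul ℝ ℝ) μ p f = _
  rw [TestFunction.integralAgainstBilinCLM_eq_integral hloc]
  simp [mul_comm]

theorem Coercive.spline_apply {b : ι → E} (hb : Coercive b Finset.univ)
    [SecondCountableTopology E] (f : Test E) :
    spline b f = ∫ x, f x ∂coneMeasure b Finset.univ := by
  have := hb.isLocallyFiniteMeasure
  rw [coneMeasure_univ] at this ⊢
  rw [spline, ofDensity_apply continuous_const]
  simp

end Distributions

/-! ### Existence and uniqueness of the polynomial part on a tope -/

section PolynomialPart

variable {E ι : Type*} [NormedAddCommGroup E] [InnerProductSpace ℝ E] [FiniteDimensional ℝ E]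
  [MeasurableSpace E] [BorelSpace E]

theorem lineDeriv_ofDensity {p : E → ℝ} (hp : ContDiff ℝ ∞ p) (v : E) :
    ∂_{v} (ofDensity (volume : Measure E) p) = ofDensity volume (dirDeriv v p) := by
  ext f
  rw [Distribution.lineDerivOp_apply_apply, map_neg, ofDensity_apply hp.continuous,
    ofDensity_apply (contDiff_dirDeriv hp v).continuous, coe_lineDeriv_test,
    integral_mul_dirDeriv volume hp (.of_test f), neg_neg]

variable [Fintype ι] {a : ι → E} {U : Set E}

/-- Each derivative removes one vector from the list; `Nodup` ensures that the vector to be removed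
is still there. -/
theorem IsChamber.foldr_lineDeriv [DecidableEq ι] (h : IsChamber a U)
    (ha : Coercive a Finset.univ) (l : List ι) (hl : l.Nodup) :
    l.foldr (fun i S => ∂_{a i} S) (ofDensity volume (locPoly volume a U Finset.univ)) =
      ofDensity volume (locPoly volume a U (Finset.univ \ l.toFinset)) := by
  induction l with
  | nil => simp
  | cons i l ih =>
    have hs : Coercive a (Finset.univ \ l.toFinset) := ha.mono (Finset.subset_univ _)
    rw [List.foldr_cons, ih hl.of_cons,
      lineDeriv_ofDensity (h.isLocPoly hs).1.smooth,
      h.dirDeriv_locPoly hs (by simpa using (List.nodup_cons.1 hl).1)]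
    congr 2
    ext j
    simp [not_or]

/-- Differentiating along a cocircuit leaves the local polynomial of its complement, which does not
span, so the result is 0. -/
theorem IsChamber.isPolynomialPart (h : IsChamber a U) (ha : Coercive a Finset.univ) :
    IsPolynomialPart a (spline a) U
      (ofDensity volume (locPoly volume a U Finset.univ)) := by
  classical
  have hp := h.isLocPoly (μ := volume) ha
  refine ⟨⟨_, hp.1, rfl⟩, fun Y hY => ?_, fun f hf => ?_⟩
  · rw [derivAlong, h.foldr_lineDeriv ha _ Y.nodup_toList, Finset.toList_toFinset,
      h.locPoly_eq_zero (ha.mono (Finset.subset_univ _))]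
    · ext f
      rw [ofDensity_apply continuous_zero]
      simp
    · have : ((Finset.univ \ Y : Finset ι) : Set ι) = {i | i ∉ Y} := by ext; simp
      rw [this]
      exact hY.prop
  · rw [ha.spline_apply, ofDensity_apply hp.1.continuous]
    exact hp.2 f (.of_test f) hf

theorem IsChamber.existsUnique_isPolynomialPart (h : IsChamber a U)
    (ha : Coercive a Finset.univ) : ∃! Q, IsPolynomialPart a (spline a) U Q := by
  refine ⟨_, h.isPolynomialPart ha, fun Q hQ => ?_⟩
  obtain ⟨⟨q, hq, rfl⟩, -, hQf⟩ := hQ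
  congr 1
  refine IsLocPoly.eq h (μ := volume) ⟨hq, fun f hf hfU => ?_⟩ (h.isLocPoly ha)
  have := hQf hf.toTest hfU
  rwa [ha.spline_apply, ofDensity_apply (IsPoly.continuous hq)] at this

theorem IsChamber.polynomialPart_eq (h : IsChamber a U) (ha : Coercive a Finset.univ) :
    polynomialPart a (spline a) U = ofDensity volume (locPoly volume a U Finset.univ) := by
  have hex : ∃ Q, IsPolynomialPart a (spline a) U Q := ⟨_, h.isPolynomialPart ha⟩
  rw [polynomialPart, dif_pos hex]
  exact (h.existsUnique_isPolynomialPart ha).unique hex.choose_spec (h.isPolynomialPart ha)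

end PolynomialPart

/-! ### Topes, regular faces and signs determined by `β` -/

section Faces

open scoped Classical

variable {V ι : Type*} [NormedAddCommGroup V] [InnerProductSpace ℝ V] [FiniteDimensional ℝ V]
  [Fintype ι] {a : ι → V} {β : V} {r : Submodule ℝ V}

theorem isOpen_topeComplement (a : ι → V) : IsOpen (topeComplement a) := by
  have : topeComplement a =
      ⋂ H ∈ (rationalSubspaces a).filter IsCoatom, ((H : Set V)ᶜ) := by
    ext x
    simp [topeComplement, and_imp]
  rw [this]
  exact isOpen_biInter_finset fun H _ => H.closed_of_finiteDimensional.isOpen_compl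

omit [FiniteDimensional ℝ V] in
theorem span_range_inter (hr : r ∈ rationalSubspaces a) :
    Submodule.span ℝ (Set.range (inter a r)) = ⊤ := by
  obtain ⟨s, -, rfl⟩ := Finset.mem_image.1 hr
  set W := Submodule.span ℝ (a '' (s : Set ι)) with hW
  apply Submodule.map_injective_of_injective W.subtype_injective
  rw [Submodule.map_span, Submodule.map_top, Submodule.range_subtype]
  refine le_antisymm (Submodule.span_le.2 ?_) (Submodule.span_mono ?_)
  · rintro _ ⟨x, _, rfl⟩
    exact x.2
  · rintro _ ⟨i, hi, rfl⟩
    exact ⟨_, ⟨⟨i, Submodule.subset_span ⟨i, hi, rfl⟩⟩, rfl⟩, rfl⟩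

theorem IsGeneric.goodSubspace (h : IsGeneric a r β) (hr : r ∈ rationalSubspaces a) :
    GoodSubspace a β r where
  isChamber :=
    { span_eq_top := span_range_inter hr
      notMem := fun s hs _ hx => connectedComponentIn_subset _ _ hx _
        (Finset.mem_image.2 ⟨s, Finset.mem_univ _, rfl⟩) hs
      isOpen := (isOpen_topeComplement _).connectedComponentIn
      isPreconnected := isPreconnected_connectedComponentIn
      nonempty := ⟨_, mem_connectedComponentIn h.1⟩ }
  mem := mem_connectedComponentIn h.1
  inner_ne_zero := h.2.2

/-- The form `⟪·, a i⟫` has no zero on the connected regular face, so its sign there is read off at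
the projection of `β`. -/
theorem forall_mem_neg_betaFace_iff (h : IsGeneric a r β) {i : ι} (hi : a i ∉ r) :
    (∀ u ∈ -betaFace a r β, ⟪u, a i⟫ < 0) ↔ 0 < ⟪rᗮ.starProjection β, a i⟫ := by
  have hmem : rᗮ.starProjection β ∈ betaFace a r β := mem_connectedComponentIn h.2
  constructor
  · intro H
    have := H (-rᗮ.starProjection β) (by simpa only [Set.mem_neg, neg_neg] using hmem)
    rwa [inner_neg_left, neg_lt_zero] at this
  · intro H u hu
    by_contra! hneg
    have hc : ContinuousOn (fun u : V => ⟪u, a i⟫) (betaFace a r β) := by fun_prop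
    have hpre : IsPreconnected (betaFace a r β) := isPreconnected_connectedComponentIn
    obtain ⟨z, hz, hz0⟩ := hpre.intermediate_value (Set.mem_neg.1 hu) hmem hc
      (show (0 : ℝ) ∈ Icc _ _ from ⟨by simpa using hneg, H.le⟩)
    exact (connectedComponentIn_subset _ _ hz).2 i hi hz0

variable [MeasurableSpace V] [BorelSpace V]

/-- The vectors negative on the opposite face are exactly those that `flip` reverses, so the list
[A, -B] and its sign become `flip` and `flipSign`. -/
theorem IsGeneric.faceSpline_apply (h : IsGeneric a r β) (hr : r ∈ rationalSubspaces a)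
    (f : Test V) :
    faceSpline a r (-betaFace a r β) f = flipSign a (rᗮ.starProjection β) r Finset.univ *
      ∫ x, f x ∂coneMeasure (flip a (rᗮ.starProjection β)) (Finset.univ.filter (a · ∉ r)) := by
  have hsigned : signed a r (-betaFace a r β) =
      fun k : {i // a i ∉ r} => flip a (rᗮ.starProjection β) k := by
    ext k
    unfold signed flip
    rw [if_congr (forall_mem_neg_betaFace_iff h k.2) rfl rfl]
  have hnum : (-1 : ℝ) ^ numNeg a r (-betaFace a r β) =
      flipSign a (rᗮ.starProjection β) r Finset.univ := by
    unfold numNeg flipSign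
    congr 2
    ext i
    simp only [Finset.mem_filter, Finset.mem_univ, true_and]
    exact and_congr_right fun hi => forall_mem_neg_betaFace_iff h hi
  have hmap : Finset.univ.map (Function.Embedding.subtype (a · ∉ r)) =
      Finset.univ.filter (a · ∉ r) := Finset.univ_map_subtype _
  have hcoer : Coercive (flip a (rᗮ.starProjection β)) (Finset.univ.filter (a · ∉ r)) :=
    .of_inner ((h.goodSubspace hr).inner_pos _)
  rw [← hmap] at hcoer ⊢
  have hcomp := hcoer.comp
  rw [coneMeasure_map]
  change ((-1 : ℝ) ^ numNeg a r (-betaFace a r β)) * spline (signed a r (-betaFace a r β)) f = _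
  rw [hnum, hsigned]
  congr 1
  exact hcomp.spline_apply f

end Faces

end

end Spline

/-! ### The decomposition theorem -/

theorem theorem4p9 {V ι : Type*} [NormedAddCommGroup V] [InnerProductSpace ℝ V]
    [FiniteDimensional ℝ V] [MeasurableSpace V] [BorelSpace V] [Fintype ι]
    (a : ι → V) (ha : ∀ i, a i ≠ 0) (hpointed : Spline.GeneratesPointedCone a)
    (β : V) (hβ : ∀ r ∈ Spline.rationalSubspaces a, Spline.IsGeneric a r β) :
    (∀ r ∈ Spline.rationalSubspaces a,
      (∃! Q : Spline.Distr r, Spline.IsPolynomialPart (Spline.inter a r) (Spline.interSpline a r)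
        (Spline.betaTope a r β) Q) ∧
      (∃! R : Spline.Distr V, Spline.IsConvolution
        (Spline.faceSpline a r (-Spline.betaFace a r β))
        (Spline.extend r (Spline.polynomialPart (Spline.inter a r) (Spline.interSpline a r)
          (Spline.betaTope a r β))) R)) ∧
    Spline.spline a = ∑ r ∈ Spline.rationalSubspaces a,
      Spline.conv (Spline.faceSpline a r (-Spline.betaFace a r β))
        (Spline.extend r (Spline.polynomialPart (Spline.inter a r) (Spline.interSpline a r)
          (Spline.betaTope a r β))) := by
  classical
  have hcoer := Spline.coercive_of_generatesPointedCone ha hpointed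
  have hgood : ∀ r ∈ Spline.rationalSubspaces a, Spline.GoodSubspace a β r :=
    fun r hr => (hβ r hr).goodSubspace hr
  have hinter (r : Submodule ℝ V) : Spline.Coercive (Spline.inter a r) Finset.univ := by
    have := hcoer.inter r
    rwa [Finset.subtype_univ] at this
  have hpart : ∀ r ∈ Spline.rationalSubspaces a,
      ∃! Q : Spline.Distr r, Spline.IsPolynomialPart (Spline.inter a r) (Spline.interSpline a r)
        (Spline.betaTope a r β) Q :=
    fun r hr => (hgood r hr).isChamber.existsUnique_isPolynomialPart (hinter r)
  have hext : ∀ r ∈ Spline.rationalSubspaces a, ∀ f : Spline.Test V,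
      Spline.extend r (Spline.polynomialPart (Spline.inter a r) (Spline.interSpline a r)
        (Spline.betaTope a r β)) f = ∫ y : r, Spline.locPoly volume (Spline.inter a r)
          (Spline.betaTope a r β) (Finset.univ.subtype (a · ∈ r)) y * f y := by
    intro r hr f
    have h1 := (hgood r hr).isChamber.polynomialPart_eq (hinter r)
    have h2 := (hgood r hr).isChamber.isLocPoly (μ := volume) (hinter r)
    rw [Finset.subtype_univ]
    change Spline.polynomialPart (Spline.inter a r) (Spline.spline (Spline.inter a r))
        (Spline.betaTope a r β) (Spline.restrictTest r f) = _
    rw [h1, Spline.ofDensity_apply h2.1.continuous]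
    rfl
  have hconv := fun r (hr : r ∈ Spline.rationalSubspaces a) =>
    Spline.existsUnique_isConvolution ((hgood r hr).isLocPoly hcoer Finset.univ).1.continuous
      ((hgood r hr).inner_pos Finset.univ) (Spline.neg_starProjection_mem r β)
      ((hβ r hr).faceSpline_apply hr) (hext r hr)
  refine ⟨fun r hr => ⟨hpart r hr, (hconv r hr).1⟩, ?_⟩
  ext f
  -- For the full list, `termValue` is the value of the convolution computed in `hconv`.
  rw [hcoer.spline_apply, Spline.integral_coneMeasure_eq_sum_termValue hcoer hgood Finset.univ
    (.of_test f), sum_apply]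
  refine Finset.sum_congr rfl fun r hr => ?_
  obtain ⟨hex, hval⟩ := hconv r hr
  rw [Spline.conv, dif_pos hex.exists]
  exact (hval _ hex.exists.choose_spec f).symm
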